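/- Fix a constant $\Delta$ and finite alphabets $\Sigma_{\mathrm{in}},\Sigma_{\mathrm{out}}$. Consider all finite simple graphs $G=(V,E)$ of maximum degree at most $\Delta$, in which every vertex $v$ carries an input label in $\Sigma_{\mathrm{in}}$ and a port numbering (a bijection between its incident edges and $\{1,\dots,\deg(v)\}$). A locally checkable labeling problem (LCL) $\mathcal P$ consists of a radius $r$ and a set $\mathcal C$ of acceptable configurations, each being a graph with a distinguished center in which every vertex has a degree, a port numbering, an input label and an output label. An output labeling $V\to\Sigma_{\mathrm{out}}$ is correct if for every $v\in V$ the subgraph induced by the $r$-neighborhood of $v$, centered at $v$ and together with the degrees (in $G$), port numbers, input labels and output labels of its vertices, is isomorphic to a member of $\mathcal C$. In the $\mathsf{RandLOCAL}$ model all vertices run the same algorithm in synchronized rounds; in each round every vertex sends one message along each incident edge. Initially a vertex knows $n=|V|$, $\Delta$, its degree, its ports, its input label and its own private, unbounded sequence of independent fair random bits. Local computation is free. On $n$-vertex graphs the algorithm stops after a specified number $T(n)$ of rounds, when every vertex outputs a label; output labels are random variables. The algorithm solves $\mathcal P$ w.h.p. if, on every $n$-vertex input graph of maximum degree at most $\Delta$,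 the output labeling is incorrect with probability at most $1/n$. Let $\mathcal P$ be any LCL and let $\mathcal A$ be a $\mathsf{RandLOCAL}$ algorithm, with messages of unbounded length, that solves $\mathcal P$ w.h.p. on graphs of maximum degree at most $\Delta$ in $T(n)=o(\log n)$ rounds. Then there is a $\mathsf{RandLOCAL}$ algorithm $\mathcal A'$ that solves $\mathcal P$ w.h.p. on graphs of maximum degree at most $\Delta$ in $O(\log n)$ rounds and in which every message is a single bit. -/

import Mathlib

open Filter Asymptotics MeasureTheory

/-- A network on the vertex set `V`: a simple graph, together with a port
numbering at every vertex (a bijection between the incident edges, given by their other endpoints,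
and `{0, …, deg v - 1}`; in particular `deg v` is the degree of `v`) and an input label at every
vertex. -/
structure Network (V Inp : Type) where
  graph : SimpleGraph V
  deg : V → ℕ
  port : ∀ v, graph.neighborSet v ≃ Fin (deg v)
  input : V → Inp

/-- A centered graph in which every vertex has a degree, a port numbering of its edges, an input
label and an output label. The degree of a vertex is part of the data, since a vertex at the
boundary of a ball may have further edges that leave the ball. `port a b h` is the port number
at `a` of the edge `{a, b}`. -/
structure Configuration (W Inp Out : Type) where
  graph : SimpleGraph W
  center : W
  deg : W → ℕ
  port : ∀ a b, graph.Adj a b → ℕ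
  input : W → Inp
  output : W → Out

/-- Isomorphism of configurations: a graph isomorphism that respects the center and all the
information stored at the vertices. -/
def Configuration.Isomorphic {W W' Inp Out : Type}
    (C : Configuration W Inp Out) (D : Configuration W' Inp Out) : Prop :=
  ∃ e : C.graph ≃g D.graph,
    e C.center = D.center ∧
    (∀ a, D.deg (e a) = C.deg a) ∧
    (∀ a b (h : C.graph.Adj a b), D.port (e a) (e b) (e.map_adj_iff.mpr h) = C.port a b h) ∧
    (∀ a, D.input (e a) = C.input a) ∧
    (∀ a, D.output (e a) = C.output a)

/-- The subgraph induced by the `r`-neighborhood of `v`, centered at `v`, with the information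
stored there: degrees and port numbers (those in the whole network), input labels and the output
labels `out`. -/
def Network.ball {V Inp Out : Type} (N : Network V Inp) (out : V → Out) (r : ℕ) (v : V) :
    Configuration {u : V // N.graph.edist v u ≤ r} Inp Out where
  graph := N.graph.comap Subtype.val
  center := ⟨v, by simp⟩
  deg a := N.deg a.1
  port a b h := N.port a.1 ⟨b.1, h⟩
  input a := N.input a.1
  output a := out a.1

/-- A locally checkable labeling problem: a radius and a set of acceptable configurations. -/
structure LCL (Inp Out : Type) where
  radius : ℕ
  accept : Set (Σ m : ℕ, Configuration (Fin m) Inp Out)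

/-- `out` is an acceptable output on `N`: every ball is isomorphic to an acceptable
configuration. -/
def LCL.Correct {V Inp Out : Type} (P : LCL Inp Out) (N : Network V Inp) (out : V → Out) : Prop :=
  ∀ v, ∃ C ∈ P.accept, (N.ball out P.radius v).Isomorphic C.2

/-- A randomized algorithm in the LOCAL model whose messages are elements of `Msg`. The initial
state of a vertex depends on the number `n` of vertices, its degree, its input label and its own
infinite sequence of random bits. On `n`-vertex graphs the algorithm runs for `rounds n` rounds.
In a round, a vertex of degree `d` in state `s` sends the message `send d s i` through its port `i`,
and, having received `m i` through each port `i`, changes its state to `receive d s m`. -/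
structure RandLocalAlgorithm (Inp Out Msg : Type) where
  State : Type
  rounds : ℕ → ℕ
  init : (n d : ℕ) → Inp → (ℕ → Bool) → State
  send : (d : ℕ) → State → Fin d → Msg
  receive : (d : ℕ) → State → (Fin d → Msg) → State
  output : State → Out

namespace RandLocalAlgorithm

variable {V Inp Out Msg : Type}

/-- One synchronous round on the network `N`. What `v` receives through port `i` is what the
neighbor `u` at the other end of that edge sends through its own port leading to `v`. -/
def step (A : RandLocalAlgorithm Inp Out Msg) (N : Network V Inp) (s : V → A.State) :
    V → A.State := fun v =>
  A.receive (N.deg v) (s v) fun i =>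
    let u := (N.port v).symm i
    A.send (N.deg u.1) (s u.1) (N.port u.1 ⟨v, N.graph.adj_symm u.2⟩)

/-- The output labeling computed on `N` when the random bits of `v` are `ω v`. -/
def run [Fintype V] (A : RandLocalAlgorithm Inp Out Msg) (N : Network V Inp)
    (ω : V → ℕ → Bool) : V → Out := fun v =>
  A.output ((A.step N)^[A.rounds (Fintype.card V)]
    (fun u => A.init (Fintype.card V) (N.deg u) (N.input u) (ω u)) v)

end RandLocalAlgorithm

/-- The law of the random bits: all bits of all vertices are independent and fair. -/
noncomputable def randomBits (V : Type) [Fintype V] : Measure (V → ℕ → Bool) :=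
  Measure.pi fun _ => Measure.infinitePi fun _ => (PMF.uniformOfFintype Bool).toMeasure

/-- `A` solves `P` with high probability on graphs of maximum degree at most `Δ`: on every network
with `n` vertices, all of degree at most `Δ`, the output labels are random variables, and the
output labeling is incorrect with probability at most `1 / n`. -/
def RandLocalAlgorithm.Solves {Inp Out Msg : Type} (A : RandLocalAlgorithm Inp Out Msg)
    (P : LCL Inp Out) (Δ : ℕ) : Prop :=
  ∀ (V : Type) [Fintype V] (N : Network V Inp), (∀ v, N.deg v ≤ Δ) →
    (∀ (v : V) (x : Out), MeasurableSet {ω | A.run N ω v = x}) ∧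
    randomBits V {ω | ¬ P.Correct N (A.run N ω)} ≤ (Fintype.card V : ENNReal)⁻¹

/-!
When `A` runs for `t = o(log n)` rounds, the balls whose radius is a constant multiple of `t` have
only `n ^ o(1)` vertices, since degrees are bounded. So there is a constant `m` such that `A`,
told that the network has `m` vertices, looks at balls with far fewer than `m` vertices, and any
such ball occurs in a network that really has `m` vertices (`Network.exists_localIso_fin`). Hence,
in a network of any size, running `A` with this constant violates `P` at a given vertex with
probability at most `1 / m`, while the number `d` of vertices whose violations are not independent
of it is tiny compared with `m`. The proof solves this constant-degree instance of the Lovász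
local lemma with one-bit messages.

*Finite randomness.* Messages of constant size cannot carry infinite random strings. Instead,
every vertex picks its string from a fixed finite palette. A palette drawn at random is good for
all of the finitely many networks with `m` vertices simultaneously, up to a factor of `2` in the
failure probability, by a bound on high moments (`exists_palette`, `exists_palette_violated_le`).

*Parallel resampling.* In every iteration, the violations whose identifier is minimal among the
violations near them resample all the variables in their neighborhoods. If a violation is
selected, then some violation within two steps of it was selected in the previous iteration
(`EventSystem.exists_selected_rel`). The resamplings that lead up to a violation after `K`
iterations therefore form a heap of pieces with at least `K + 1` nonempty levels. Which table
entries a piece has seen can be read off from the heap (`EventSystem.card_resampled_eq_above`),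
and different pieces see different entries, so that a heap with `s` pieces has probability at most
`p ^ s`. Summing over all heaps, one level at a time (`EventSystem.sum_chains_le`), gives a
failure probability of at most `n * 2⁻¹ ^ K` (`EventSystem.measure_exists_bad_le`). The union
bound does not refer to the identifiers, so these may be random as well.

*Implementation.* Identifiers of `O(log n)` random bits are published bit by bit, so that each
round costs only a constant number of bits. Once they are known within a constant radius, they
turn the view of a vertex, which by itself is a tree of walks, into an honest picture of its ball
(`Network.exists_localIso_of_view_eq`). Then `O(log n)` iterations of resampling follow, in which
only the current colors have to be published. Publishing symbols from a finite set within a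
constant radius is simulated by one-bit messages with constant overhead
(`PublishingAlgorithm.exists_bool_simulation`).
-/

/-! ### Independent identically distributed families -/

/-- The law of a family of independent random variables indexed by `ι`, all with law `ν`. -/
noncomputable def iidLaw (ι : Type*) {X : Type*} [MeasurableSpace X] (ν : Measure X) :
    Measure (ι → X) :=
  Measure.infinitePi fun _ : ι => ν

/-- The law of a fair coin. -/
noncomputable def coin : Measure Bool := (PMF.uniformOfFintype Bool).toMeasure

instance : IsProbabilityMeasure coin := by
  unfold coin; infer_instance

instance {ι X : Type*} [MeasurableSpace X] (ν : Measure X) [IsProbabilityMeasure ν] :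
    IsProbabilityMeasure (iidLaw ι ν) := by
  unfold iidLaw; infer_instance

lemma randomBits_eq_iidLaw (V : Type) [Fintype V] :
    randomBits V = iidLaw V (iidLaw ℕ coin) := by
  unfold randomBits iidLaw coin
  rw [← Measure.infinitePi_eq_pi]

instance (V : Type) [Fintype V] : IsProbabilityMeasure (randomBits V) := by
  rw [randomBits_eq_iidLaw]; infer_instance

section iid

variable {ι κ X : Type*} [MeasurableSpace X] (ν : Measure X) [IsProbabilityMeasure ν]

lemma measurePreserving_iidLaw_comp {g : κ → ι} (hg : Function.Injective g) :
    MeasurePreserving (fun (y : ι → X) k => y (g k)) (iidLaw ι ν) (iidLaw κ ν) :=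
  ⟨by fun_prop, Measure.map_infinitePi_infinitePi_of_inj hg⟩

lemma measurePreserving_iidLaw_curry :
    MeasurePreserving (fun (y : ι × κ → X) i k => y (i, k)) (iidLaw (ι × κ) ν)
      (iidLaw ι (iidLaw κ ν)) :=
  ⟨by fun_prop, Measure.infinitePi_map_curry (ι := ι) (κ := κ) fun _ _ => ν⟩

lemma measurePreserving_iidLaw_uncurry :
    MeasurePreserving (fun (y : ι → κ → X) (p : ι × κ) => y p.1 p.2) (iidLaw ι (iidLaw κ ν))
      (iidLaw (ι × κ) ν) :=
  ⟨by fun_prop, Measure.infinitePi_map_curry_symm (ι := ι) (κ := κ) fun _ _ => ν⟩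

lemma iidLaw_forall_mem [Fintype ι] (S : ι → Set X) :
    iidLaw ι ν {y | ∀ i, y i ∈ S i} = ∏ i, ν (S i) := by
  unfold iidLaw
  rw [Measure.infinitePi_eq_pi, ← Measure.pi_pi]
  congr 1
  ext y; simp

/-- Events that look at disjoint sets of coordinates are independent: the `j`-th event depends on
the coordinates `g ⟨j, x⟩`, and all these coordinates are distinct. -/
lemma iidLaw_forall_mem_of_disjoint [Finite X] [MeasurableSingletonClass X]
    {J : Type*} [Fintype J] {κ : J → Type*} [∀ j, Finite (κ j)]
    {g : (Σ j, κ j) → ι} (hg : Function.Injective g) (Q : ∀ j, Set (κ j → X)) :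
    iidLaw ι ν {T | ∀ j, (fun x => T (g ⟨j, x⟩)) ∈ Q j} = ∏ j, iidLaw (κ j) ν (Q j) := by
  have hQ : ∀ j, MeasurableSet (Q j) := fun j => (Set.toFinite _).measurableSet
  have h1 : MeasurePreserving (fun (y : (Σ j, κ j) → X) j k => y ⟨j, k⟩)
      (iidLaw (Σ j, κ j) ν) (Measure.infinitePi fun j => iidLaw (κ j) ν) :=
    ⟨by fun_prop, Measure.infinitePi_map_piCurry (κ := κ) fun _ _ => ν⟩
  have h2 := h1.comp (measurePreserving_iidLaw_comp ν hg)
  have h3 : MeasurableSet {y : ∀ j, κ j → X | ∀ j, y j ∈ Q j} := by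
    rw [Set.ofPred_forall]
    exact MeasurableSet.iInter fun j => (hQ j).preimage (measurable_pi_apply j)
  rw [show {T : ι → X | ∀ j, (fun x => T (g ⟨j, x⟩)) ∈ Q j}
    = ((fun (y : (Σ j, κ j) → X) j k => y ⟨j, k⟩) ∘ (fun (y : ι → X) k => y (g k))) ⁻¹'
      {y : ∀ j, κ j → X | ∀ j, y j ∈ Q j} from rfl, h2.measure_preimage h3.nullMeasurableSet,
    Measure.infinitePi_eq_pi, ← Measure.pi_pi]
  congr 1
  ext y; simp

end iid

lemma iidLaw_coin_singleton {κ : Type*} [Fintype κ] (z : κ → Bool) :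
    iidLaw κ coin {z} = (2⁻¹ : ENNReal) ^ Fintype.card κ := by
  unfold iidLaw
  rw [Measure.infinitePi_singleton_of_fintype]
  simp [coin]

/-! ### Parallel resampling -/

/-- A system of bad events on variables indexed by `V`, with values in `Y`, one event for every
`v : V`. The event of `v` only looks at the variables in `vbl v`, and events with a common variable
are `near` each other. -/
structure EventSystem (V Y : Type) where
  vbl : V → Set V
  near : V → V → Prop
  bad : (V → Y) → V → Prop
  near_refl : ∀ v, near v v
  near_symm : ∀ {u v}, near u v → near v u
  near_of_mem : ∀ {u v x}, x ∈ vbl u → x ∈ vbl v → near u v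
  bad_congr : ∀ {y y' : V → Y} {v}, (∀ x ∈ vbl v, y x = y' x) → bad y v → bad y' v

namespace EventSystem

variable {V Y J : Type} [LinearOrder J] (S : EventSystem V Y)

/-- Two steps of `near`. -/
def rel (u v : V) : Prop := ∃ w, S.near u w ∧ S.near w v

lemma rel_symm {u v : V} (h : S.rel u v) : S.rel v u :=
  let ⟨w, h₁, h₂⟩ := h
  ⟨w, S.near_symm h₂, S.near_symm h₁⟩

lemma rel_of_near {u v : V} (h : S.near u v) : S.rel u v := ⟨v, h, S.near_refl v⟩

/-- A bad event is selected for resampling if no bad event near it has a smaller identifier. -/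
def selected (id : V → J) (y : V → Y) (v : V) : Prop :=
  S.bad y v ∧ ∀ u, S.near v u → S.bad y u → id v ≤ id u

/-- A variable is resampled if it belongs to a selected event. -/
def resampled (id : V → J) (y : V → Y) (x : V) : Prop :=
  ∃ v, S.selected id y v ∧ x ∈ S.vbl v

open Classical in
/-- How often each variable has been resampled after `i` iterations, when the successive values of
the variable `x` are `X x 0, X x 1, …`. -/
noncomputable def counter (id : V → J) (X : V → ℕ → Y) : ℕ → V → ℕ
  | 0 => fun _ => 0
  | i + 1 => fun x => counter id X i x +
      if S.resampled id (fun z => X z (counter id X i z)) x then 1 else 0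

/-- The values of the variables after `i` iterations. -/
noncomputable def current (id : V → J) (X : V → ℕ → Y) (i : ℕ) : V → Y :=
  fun x => X x (S.counter id X i x)

variable {S} {id : V → J} {X : V → ℕ → Y}

lemma exists_selected_of_bad [Finite V] {y : V → Y} {v : V} (h : S.bad y v) :
    ∃ u, S.selected id y u := by
  obtain ⟨u, hu, hmin⟩ := Set.exists_min_image {u | S.bad y u} id (Set.toFinite _) ⟨v, h⟩
  exact ⟨u, hu, fun w _ hw => hmin w hw⟩

lemma eq_of_selected_of_near (hid : Function.Injective id) {y : V → Y} {u v : V}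
    (hu : S.selected id y u) (hv : S.selected id y v) (h : S.near u v) : u = v :=
  hid (le_antisymm (hu.2 v h hv.1) (hv.2 u (S.near_symm h) hu.1))

lemma counter_succ_of_not_resampled {i : ℕ} {x : V}
    (h : ¬ S.resampled id (S.current id X i) x) :
    S.counter id X (i + 1) x = S.counter id X i x := by
  unfold current at h
  simp [counter, h]

lemma counter_succ_of_resampled {i : ℕ} {x : V}
    (h : S.resampled id (S.current id X i) x) :
    S.counter id X (i + 1) x = S.counter id X i x + 1 := by
  unfold current at h
  simp [counter, h]

/-- An event whose status changes has a resampled variable. -/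
lemma exists_selected_near_of_bad_iff {i : ℕ} {v : V}
    (h : ¬ (S.bad (S.current id X i) v ↔ S.bad (S.current id X (i + 1)) v)) :
    ∃ u, S.selected id (S.current id X i) u ∧ S.near v u := by
  by_contra! hne
  have heq : ∀ x ∈ S.vbl v, S.current id X i x = S.current id X (i + 1) x := by
    intro x hx
    have : ¬ S.resampled id (S.current id X i) x := by
      rintro ⟨u, hu, hxu⟩
      exact hne u hu (S.near_of_mem hx hxu)
    simp only [current, counter_succ_of_not_resampled this]
  exact h ⟨S.bad_congr heq, S.bad_congr fun x hx => (heq x hx).symm⟩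

/-- A selected event has a cause one iteration earlier: either it has just become bad, or an event
near it with a smaller identifier has just ceased to be bad. -/
lemma exists_selected_rel {i : ℕ} {v : V} (hv : S.selected id (S.current id X (i + 1)) v) :
    ∃ u, S.selected id (S.current id X i) u ∧ S.rel v u := by
  by_cases h₁ : S.bad (S.current id X i) v
  · by_cases h₂ : S.selected id (S.current id X i) v
    · exact ⟨v, h₂, S.rel_of_near (S.near_refl v)⟩
    · unfold selected at h₂
      push Not at h₂
      obtain ⟨u, hvu, hu, hlt⟩ := h₂ h₁
      have hu' : ¬ S.bad (S.current id X (i + 1)) u := fun h =>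
        absurd (hv.2 u hvu h) (not_le.mpr hlt)
      obtain ⟨w, hw, huw⟩ := exists_selected_near_of_bad_iff
        (show ¬ (S.bad (S.current id X i) u ↔ S.bad (S.current id X (i + 1)) u) by tauto)
      exact ⟨w, hw, u, hvu, huw⟩
  · obtain ⟨w, hw, hvw⟩ := exists_selected_near_of_bad_iff
      (show ¬ (S.bad (S.current id X i) v ↔ S.bad (S.current id X (i + 1)) v) from
        fun h => h₁ (h.mpr hv.1))
    exact ⟨w, hw, S.rel_of_near hvw⟩

open Classical in
lemma counter_eq_card (i : ℕ) (x : V) :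
    S.counter id X i x =
      ((Finset.range i).filter fun j => S.resampled id (S.current id X j) x).card := by
  induction i with
  | zero => simp [counter]
  | succ i ih =>
    rw [Finset.range_add_one, Finset.filter_insert]
    by_cases h : S.resampled id (S.current id X i) x
    · rw [if_pos h, Finset.card_insert_of_notMem (by simp), counter_succ_of_resampled h, ih]
    · rw [if_neg h, counter_succ_of_not_resampled h, ih]

/-! ### The causes of a late resampling -/

section Heights

variable [Fintype V] (S)

open Classical in
/-- The selected events `sel (K - m)`, for `m = 0, 1, …`, are dropped like pieces onto a heap whose
bottom piece is the event `root`, at height `1`. A piece that would land on no earlier one (in the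
sense of `rel`) is discarded, and any other one comes to lie directly above the highest piece below
it. `height` is the height of the topmost piece of `w` after step `m`, and `0` if there is none. -/
noncomputable def height (sel : ℕ → V → Prop) (K : ℕ) (root : V) : ℕ → V → ℕ
  | 0 => fun w => if w = root then 1 else 0
  | m + 1 => fun w =>
      if sel (K - (m + 1)) w ∧ ∃ u, S.rel w u ∧ 0 < height sel K root m u then
        1 + (Finset.univ.filter fun u => S.rel w u).sup (height sel K root m)
      else height sel K root m w

/-- A piece of `w` is added to the heap in step `m`. -/
def Added (sel : ℕ → V → Prop) (K : ℕ) (root : V) : ℕ → V → Prop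
  | 0 => fun w => w = root
  | m + 1 => fun w => sel (K - (m + 1)) w ∧ ∃ u, S.rel w u ∧ 0 < S.height sel K root m u

variable {S} {sel : ℕ → V → Prop} {K : ℕ} {root : V}

lemma height_succ_of_not_added {m : ℕ} {w : V} (h : ¬ S.Added sel K root (m + 1) w) :
    S.height sel K root (m + 1) w = S.height sel K root m w := by
  unfold Added at h
  rw [height]
  exact if_neg h

open Classical in
lemma height_succ_of_added {m : ℕ} {w : V} (h : S.Added sel K root (m + 1) w) :
    S.height sel K root (m + 1) w =
      1 + (Finset.univ.filter fun u => S.rel w u).sup (S.height sel K root m) := by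
  rw [height]
  exact if_pos h

lemma height_lt_of_added_succ {m : ℕ} {w u : V} (h : S.Added sel K root (m + 1) w)
    (hu : S.rel w u) : S.height sel K root m u < S.height sel K root (m + 1) w := by
  classical
  rw [height_succ_of_added h, Nat.lt_one_add_iff]
  exact Finset.le_sup (f := S.height sel K root m) (by simpa using hu)

lemma exists_height_eq_of_added {m : ℕ} {w : V} (h : S.Added sel K root (m + 1) w) :
    ∃ u, S.rel w u ∧ 0 < S.height sel K root m u ∧
      S.height sel K root (m + 1) w = S.height sel K root m u + 1 := by
  classical
  obtain ⟨-, u₀, hu₀, hpos⟩ := id h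
  obtain ⟨u, hu, hsup⟩ := Finset.exists_mem_eq_sup (Finset.univ.filter fun u => S.rel w u)
    ⟨u₀, by simpa using hu₀⟩ (S.height sel K root m)
  refine ⟨u, by simpa using hu, ?_, ?_⟩
  · rw [← hsup]
    exact hpos.trans_le (Finset.le_sup (f := S.height sel K root m) (by simpa using hu₀))
  · rw [height_succ_of_added h, hsup, add_comm]

lemma height_mono (w : V) : Monotone fun m => S.height sel K root m w := by
  refine monotone_nat_of_le_succ fun m => ?_
  by_cases h : S.Added sel K root (m + 1) w
  · exact (height_lt_of_added_succ h (S.rel_of_near (S.near_refl w))).le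
  · exact (height_succ_of_not_added h).ge

lemma height_lt_of_added {a b : ℕ} {w u : V} (h : S.Added sel K root b w) (hab : a < b)
    (hu : S.rel w u) : S.height sel K root a u < S.height sel K root b w := by
  obtain ⟨m, rfl⟩ : ∃ m, b = m + 1 := ⟨b - 1, by omega⟩
  exact (height_mono u (Nat.lt_succ_iff.mp hab)).trans_lt (height_lt_of_added_succ h hu)

lemma exists_added_of_height_pos {m : ℕ} {w : V} (h : 0 < S.height sel K root m w) :
    ∃ a ≤ m, S.Added sel K root a w ∧ S.height sel K root a w = S.height sel K root m w := by
  induction m with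
  | zero =>
    refine ⟨0, le_rfl, ?_, rfl⟩
    by_contra hne
    simp [height, show w ≠ root from hne] at h
  | succ m ih =>
    by_cases hm : S.Added sel K root (m + 1) w
    · exact ⟨m + 1, le_rfl, hm, rfl⟩
    · rw [height_succ_of_not_added hm] at h ⊢
      obtain ⟨a, ha, h₁, h₂⟩ := ih h
      exact ⟨a, ha.trans m.le_succ, h₁, h₂⟩

lemma height_pos_of_added {m : ℕ} {w : V} (h : S.Added sel K root m w) :
    0 < S.height sel K root m w := by
  cases m with
  | zero => simp [height, show w = root from h]
  | succ m =>
    obtain ⟨u, -, -, h⟩ := exists_height_eq_of_added h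
    omega

lemma height_le (m : ℕ) (w : V) : S.height sel K root m w ≤ m + 1 := by
  induction m generalizing w with
  | zero => unfold height; split_ifs <;> omega
  | succ m ih =>
    by_cases h : S.Added sel K root (m + 1) w
    · obtain ⟨u, -, -, h⟩ := exists_height_eq_of_added h
      have := ih u
      omega
    · rw [height_succ_of_not_added h]
      exact (ih w).trans (by omega)

lemma eq_root_of_height_eq_one {m : ℕ} {w : V} (h : S.height sel K root m w = 1) : w = root := by
  obtain ⟨a, -, ha, hh⟩ := exists_added_of_height_pos (by omega : 0 < S.height sel K root m w)
  cases a with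
  | zero => exact ha
  | succ a =>
    obtain ⟨u, -, hpos, h'⟩ := exists_height_eq_of_added ha
    omega

lemma sel_of_added (hroot : sel K root) {m : ℕ} {w : V} (h : S.Added sel K root m w) :
    sel (K - m) w := by
  cases m with
  | zero => rw [show w = root from h]; exact hroot
  | succ m => exact h.1

/-- Two pieces near each other at the same height are the same piece. -/
lemma eq_and_eq_of_height_eq (hroot : sel K root)
    (hsel : ∀ i u v, sel i u → sel i v → S.near u v → u = v) {a b : ℕ} {u w : V}
    (hu : S.Added sel K root a u) (hw : S.Added sel K root b w) (hn : S.near u w)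
    (h : S.height sel K root a u = S.height sel K root b w) : a = b ∧ u = w := by
  have hab : a = b := by
    rcases lt_trichotomy a b with hlt | heq | hgt
    · exact absurd h (height_lt_of_added hw hlt (S.rel_of_near (S.near_symm hn))).ne
    · exact heq
    · exact absurd h (height_lt_of_added hu hgt (S.rel_of_near hn)).ne'
  subst hab
  exact ⟨rfl, hsel _ _ _ (sel_of_added hroot hu) (sel_of_added hroot hw) hn⟩

lemma exists_height_eq (hroot : sel K root)
    (hchain : ∀ i v, sel (i + 1) v → ∃ u, sel i u ∧ S.rel v u) {m : ℕ} (hm : m ≤ K) :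
    ∃ u, sel (K - m) u ∧ S.height sel K root m u = m + 1 := by
  induction m with
  | zero => exact ⟨root, hroot, by simp [height]⟩
  | succ m ih =>
    obtain ⟨u, hu, hh⟩ := ih (by omega)
    rw [show K - m = K - (m + 1) + 1 by omega] at hu
    obtain ⟨w, hw, hrel⟩ := hchain _ _ hu
    have hadd : S.Added sel K root (m + 1) w := ⟨hw, u, S.rel_symm hrel, by omega⟩
    have h₁ := height_lt_of_added_succ hadd (S.rel_symm hrel)
    have h₂ : S.height sel K root (m + 1) w ≤ m + 1 + 1 := height_le _ _
    exact ⟨w, hw, by omega⟩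

open Classical in
variable (S sel K root) in
/-- The set of events that have a piece at height `δ + 1`. -/
noncomputable def level (δ : ℕ) : Finset V :=
  Finset.univ.filter fun w => ∃ m ≤ K, S.height sel K root m w = δ + 1

lemma mem_level {δ : ℕ} {w : V} : w ∈ S.level sel K root δ ↔
    ∃ m ≤ K, S.Added sel K root m w ∧ S.height sel K root m w = δ + 1 := by
  simp only [level, Finset.mem_filter, Finset.mem_univ, true_and]
  constructor
  · rintro ⟨m, hm, h⟩
    obtain ⟨a, ha, h₁, h₂⟩ := exists_added_of_height_pos (by omega : 0 < S.height sel K root m w)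
    exact ⟨a, ha.trans hm, h₁, h₂.trans h⟩
  · rintro ⟨m, hm, -, h⟩
    exact ⟨m, hm, h⟩

lemma level_zero : S.level sel K root 0 = {root} := by
  ext w
  rw [mem_level, Finset.mem_singleton]
  constructor
  · rintro ⟨m, -, -, h⟩
    exact eq_root_of_height_eq_one h
  · rintro rfl
    exact ⟨0, Nat.zero_le _, rfl, by simp [height]⟩

lemma exists_rel_of_mem_level_succ {δ : ℕ} {w : V} (h : w ∈ S.level sel K root (δ + 1)) :
    ∃ u ∈ S.level sel K root δ, S.rel u w := by
  obtain ⟨m, hm, hadd, hh⟩ := mem_level.mp h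
  cases m with
  | zero =>
    have := height_le (S := S) (sel := sel) (K := K) (root := root) 0 w
    omega
  | succ m =>
    obtain ⟨u, hrel, -, hu⟩ := exists_height_eq_of_added hadd
    refine ⟨u, ?_, S.rel_symm hrel⟩
    simp only [level, Finset.mem_filter, Finset.mem_univ, true_and]
    exact ⟨m, by omega, by omega⟩

lemma level_nonempty (hroot : sel K root)
    (hchain : ∀ i v, sel (i + 1) v → ∃ u, sel i u ∧ S.rel v u) {δ : ℕ} (hδ : δ ≤ K) :
    (S.level sel K root δ).Nonempty := by
  obtain ⟨u, -, hu⟩ := exists_height_eq (S := S) hroot hchain hδ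
  refine ⟨u, ?_⟩
  simp only [level, Finset.mem_filter, Finset.mem_univ, true_and]
  exact ⟨δ, hδ, hu⟩

lemma level_eq_empty {δ : ℕ} (hδ : K < δ) : S.level sel K root δ = ∅ := by
  rw [Finset.eq_empty_iff_forall_notMem]
  intro w hw
  obtain ⟨m, hm, -, hh⟩ := mem_level.mp hw
  have := height_le (S := S) (sel := sel) (K := K) (root := root) m w
  omega

lemma eq_of_mem_level_of_near (hroot : sel K root)
    (hsel : ∀ i u v, sel i u → sel i v → S.near u v → u = v) {δ : ℕ} {u w : V}
    (hu : u ∈ S.level sel K root δ) (hw : w ∈ S.level sel K root δ) (hn : S.near u w) : u = w := by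
  obtain ⟨a, -, ha, hha⟩ := mem_level.mp hu
  obtain ⟨b, -, hb, hhb⟩ := mem_level.mp hw
  exact (eq_and_eq_of_height_eq hroot hsel ha hb hn (hha.trans hhb.symm)).2

open Classical in
variable (S) in
/-- The number of levels between `δ` (excluded) and `K` that have a piece containing `x`. -/
noncomputable def above (K : ℕ) (L : ℕ → Finset V) (δ : ℕ) (x : V) : ℕ :=
  ((Finset.range (K + 1)).filter fun δ' => δ < δ' ∧ ∃ u ∈ L δ', x ∈ S.vbl u).card

/-- The heap determines which values a piece has seen: before the event `w` was selected, a variable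
`x` of `w` had been resampled once for every higher piece that contains `x`. -/
lemma card_resampled_eq_above (hroot : sel K root)
    (hsel : ∀ i u v, sel i u → sel i v → S.near u v → u = v) {m : ℕ} (hm : m ≤ K) {w : V}
    (hadd : S.Added sel K root m w) {δ : ℕ} (hδ : S.height sel K root m w = δ + 1) {x : V}
    (hx : x ∈ S.vbl w) [DecidablePred fun j => ∃ u, sel j u ∧ x ∈ S.vbl u] :
    ((Finset.range (K - m)).filter fun j => ∃ u, sel j u ∧ x ∈ S.vbl u).card =
      S.above K (S.level sel K root) δ x := by
  classical
  have hex : ∀ j, (∃ u, sel j u ∧ x ∈ S.vbl u) → ∃ u, sel j u ∧ x ∈ S.vbl u := fun _ h => h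
  have : Nonempty V := ⟨w⟩
  choose! u hu using hex
  -- every later resampling of `x` adds a piece, since it is near the piece of `w`
  have hadded : ∀ j < K - m, (∃ u, sel j u ∧ x ∈ S.vbl u) → S.Added sel K root (K - j) (u j) := by
    intro j hj h
    obtain ⟨l, hl⟩ : ∃ l, K - j = l + 1 := ⟨K - j - 1, by omega⟩
    rw [hl]
    refine ⟨?_, w, S.rel_of_near (S.near_of_mem (hu j h).2 hx), ?_⟩
    · rw [← hl, show K - (K - j) = j by omega]
      exact (hu j h).1
    · exact (height_pos_of_added hadd).trans_le (height_mono w (by omega : m ≤ l))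
  have hlt : ∀ j < K - m, (∃ u, sel j u ∧ x ∈ S.vbl u) →
      δ + 1 < S.height sel K root (K - j) (u j) := by
    intro j hj h
    rw [← hδ]
    exact height_lt_of_added (hadded j hj h) (by omega)
      (S.rel_of_near (S.near_of_mem (hu j h).2 hx))
  unfold above
  refine Finset.card_bij (fun j _ => S.height sel K root (K - j) (u j) - 1) ?_ ?_ ?_
  · intro j hj
    rw [Finset.mem_filter, Finset.mem_range] at hj
    have h₁ := hlt j hj.1 hj.2
    have h₂ := height_le (S := S) (sel := sel) (K := K) (root := root) (K - j) (u j)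
    rw [Finset.mem_filter, Finset.mem_range]
    exact ⟨by omega, by omega, u j, mem_level.mpr ⟨K - j, by omega, hadded j hj.1 hj.2, by omega⟩,
      (hu j hj.2).2⟩
  · intro j hj j' hj' heq
    rw [Finset.mem_filter, Finset.mem_range] at hj hj'
    have h₁ := hlt j hj.1 hj.2
    have h₂ := hlt j' hj'.1 hj'.2
    have := (eq_and_eq_of_height_eq hroot hsel (hadded j hj.1 hj.2) (hadded j' hj'.1 hj'.2)
      (S.near_of_mem (hu j hj.2).2 (hu j' hj'.2).2) (by omega)).1
    omega
  · intro δ' hδ'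
    rw [Finset.mem_filter, Finset.mem_range] at hδ'
    obtain ⟨-, hlt', v, hv, hxv⟩ := hδ'
    obtain ⟨a, ha, haAdd, hah⟩ := mem_level.mp hv
    have hma : m < a := by
      by_contra! hle
      rcases hle.lt_or_eq with h | h
      · have := height_lt_of_added hadd h (S.rel_of_near (S.near_of_mem hx hxv))
        omega
      · subst h
        have := hsel _ _ _ (sel_of_added hroot haAdd) (sel_of_added hroot hadd)
          (S.near_of_mem hxv hx)
        subst this
        omega
    have hsv := sel_of_added hroot haAdd
    have hj : ∃ u, sel (K - a) u ∧ x ∈ S.vbl u := ⟨v, hsv, hxv⟩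
    have huv : u (K - a) = v :=
      hsel _ _ _ (hu _ hj).1 hsv (S.near_of_mem (hu _ hj).2 hxv)
    refine ⟨K - a, ?_, ?_⟩
    · rw [Finset.mem_filter, Finset.mem_range]
      exact ⟨by omega, hj⟩
    · simp only [huv, show K - (K - a) = a by omega, hah]
      omega

end Heights

end EventSystem

namespace EventSystem

variable {V Y J : Type} [LinearOrder J] [Fintype V] (S : EventSystem V Y)

/-! ### The union bound -/

section Chains

open Classical in
/-- The events that are `rel`ated to a member of `A`. -/
noncomputable def hull (A : Finset V) : Finset V :=
  Finset.univ.filter fun w => ∃ u ∈ A, S.rel u w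

/-- The sequence `A, L 0, L 1, …`. -/
def consSeq {W : Type} (A : Finset W) (L : ℕ → Finset W) : ℕ → Finset W
  | 0 => A
  | n + 1 => L n

lemma consSeq_injective {W : Type} (A : Finset W) : Function.Injective (consSeq A) := fun _ _ h =>
  funext fun n => congrFun h (n + 1)

open Classical in
/-- The sequences of sets of events that start with `A`, continue with `m` nonempty sets, each in
the hull of the previous one, and are empty from then on. -/
noncomputable def chains : ℕ → Finset V → Finset (ℕ → Finset V)
  | 0, A => {consSeq A fun _ => ∅}
  | m + 1, A => ((S.hull A).powerset.filter (·.Nonempty)).biUnion fun B =>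
      (chains m B).image (consSeq A)

variable {S}

lemma apply_zero_of_mem_chains {m : ℕ} {A : Finset V} {L : ℕ → Finset V}
    (h : L ∈ S.chains m A) : L 0 = A := by
  cases m with
  | zero => rw [chains, Finset.mem_singleton] at h; rw [h, consSeq]
  | succ m =>
    simp only [chains, Finset.mem_biUnion, Finset.mem_image] at h
    obtain ⟨B, -, L', -, rfl⟩ := h
    rfl

lemma mem_chains {m : ℕ} {A : Finset V} {L : ℕ → Finset V} (h₀ : L 0 = A)
    (h₁ : ∀ δ < m, (L (δ + 1)).Nonempty ∧ L (δ + 1) ⊆ S.hull (L δ))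
    (h₂ : ∀ δ, m < δ → L δ = ∅) : L ∈ S.chains m A := by
  induction m generalizing A L with
  | zero =>
    rw [chains, Finset.mem_singleton]
    funext n
    cases n with
    | zero => exact h₀
    | succ n => exact h₂ _ n.succ_pos
  | succ m ih =>
    simp only [chains, Finset.mem_biUnion, Finset.mem_image, Finset.mem_filter,
      Finset.mem_powerset]
    refine ⟨L 1, ⟨?_, (h₁ 0 m.succ_pos).1⟩, fun n => L (n + 1),
      ih rfl (fun δ hδ => h₁ _ (by omega)) fun δ hδ => h₂ _ (by omega), ?_⟩
    · rw [← h₀]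
      exact (h₁ 0 m.succ_pos).2
    · funext n
      cases n with
      | zero => exact h₀.symm
      | succ n => rfl

lemma card_hull_le {d : ℕ} (hd : ∀ w, {u | S.rel w u}.ncard ≤ d) (A : Finset V) :
    (S.hull A).card ≤ d * A.card := by
  classical
  have : S.hull A = A.biUnion fun u => Finset.univ.filter fun w => S.rel u w := by
    ext w; simp [hull]
  rw [this, mul_comm]
  refine Finset.card_biUnion_le_card_mul _ _ _ fun u _ => ?_
  rw [← Set.ncard_coe_finset]
  simpa using hd u

/-- The level-by-level form of the union bound: the sum telescopes since
`∑ B ⊆ hull A, (4 p) ^ |B| = (1 + 4 p) ^ |hull A| ≤ 2 ^ |A|`, and each nonempty level pays for a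
factor `1 / 2`. -/
lemma sum_chains_le {d : ℕ} (hd : ∀ w, {u | S.rel w u}.ncard ≤ d) {p : ENNReal}
    (hp : (1 + 4 * p) ^ d ≤ 2) (m : ℕ) (A : Finset V) :
    ∑ L ∈ S.chains m A, ∏ δ ∈ Finset.range (m + 1), p ^ (L δ).card ≤
      p ^ A.card * (2⁻¹ ^ m * 2 ^ A.card) := by
  classical
  induction m generalizing A with
  | zero =>
    simp only [chains, Finset.sum_singleton, zero_add, Finset.prod_range_one, pow_zero, one_mul]
    exact le_mul_of_one_le_right zero_le (one_le_pow₀ one_le_two)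
  | succ m ih =>
    rw [chains, Finset.sum_biUnion]
    swap
    · intro B _ B' _ hne
      rw [Function.onFun, Finset.disjoint_left]
      intro L hL hL'
      rw [Finset.mem_image] at hL hL'
      obtain ⟨L₁, h₁, rfl⟩ := hL
      obtain ⟨L₂, h₂, heq⟩ := hL'
      have := consSeq_injective A heq
      subst this
      exact hne ((apply_zero_of_mem_chains h₁).symm.trans (apply_zero_of_mem_chains h₂))
    calc ∑ B ∈ (S.hull A).powerset.filter (·.Nonempty),
          ∑ L ∈ (S.chains m B).image (consSeq A),
            ∏ δ ∈ Finset.range (m + 1 + 1), p ^ (L δ).card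
        = ∑ B ∈ (S.hull A).powerset.filter (·.Nonempty), p ^ A.card *
            ∑ L ∈ S.chains m B, ∏ δ ∈ Finset.range (m + 1), p ^ (L δ).card := by
          refine Finset.sum_congr rfl fun B _ => ?_
          rw [Finset.sum_image (consSeq_injective A).injOn, Finset.mul_sum]
          refine Finset.sum_congr rfl fun L _ => ?_
          rw [Finset.prod_range_succ', mul_comm]
          rfl
      _ ≤ ∑ B ∈ (S.hull A).powerset.filter (·.Nonempty), p ^ A.card *
            (2⁻¹ ^ (m + 1) * (4 * p) ^ B.card) := by
          refine Finset.sum_le_sum fun B hB => mul_le_mul_right ((ih B).trans ?_) _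
          have hB : B.card ≠ 0 := Finset.card_ne_zero.mpr (Finset.mem_filter.mp hB).2
          calc p ^ B.card * (2⁻¹ ^ m * 2 ^ B.card)
              = 2⁻¹ ^ m * (2⁻¹ * 2) * 2 ^ B.card * p ^ B.card := by
                rw [ENNReal.inv_mul_cancel two_ne_zero ENNReal.ofNat_ne_top]; ring
            _ = 2⁻¹ ^ (m + 1) * (2 * (2 ^ B.card * p ^ B.card)) := by ring
            _ ≤ 2⁻¹ ^ (m + 1) * (2 ^ B.card * (2 ^ B.card * p ^ B.card)) := by
                gcongr
                exact le_self_pow₀ one_le_two hB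
            _ = 2⁻¹ ^ (m + 1) * (4 * p) ^ B.card := by
                rw [show (4 : ENNReal) = 2 * 2 by norm_num, mul_pow, mul_pow]; ring
      _ ≤ ∑ B ∈ (S.hull A).powerset, p ^ A.card * (2⁻¹ ^ (m + 1) * (4 * p) ^ B.card) :=
          Finset.sum_le_sum_of_subset (Finset.filter_subset _ _)
      _ = p ^ A.card * (2⁻¹ ^ (m + 1) * (1 + 4 * p) ^ (S.hull A).card) := by
          rw [← Finset.mul_sum, ← Finset.mul_sum, add_comm 1 (4 * p),
            ← Finset.sum_pow_mul_eq_add_pow]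
          simp
      _ ≤ p ^ A.card * (2⁻¹ ^ (m + 1) * 2 ^ A.card) := by
          refine mul_le_mul_right (mul_le_mul_right ?_ _) _
          calc (1 + 4 * p) ^ (S.hull A).card ≤ (1 + 4 * p) ^ (d * A.card) :=
                pow_le_pow_right₀ (le_add_of_nonneg_right zero_le) (card_hull_le hd A)
            _ ≤ 2 ^ A.card := by
                rw [pow_mul]
                gcongr

end Chains

section Measure

variable [MeasurableSpace Y] [MeasurableSingletonClass Y] [Finite Y]
  (ν : Measure Y) [IsProbabilityMeasure ν]

variable {S}

/-- The probability that all the pieces of a heap `L` are bad, when they see the values that `L`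
itself determines. These values are distinct table entries for distinct pieces. -/
lemma measure_forall_bad_le {p : ENNReal} (hp : ∀ w, iidLaw V ν {y | S.bad y w} ≤ p) {K : ℕ}
    {L : ℕ → Finset V} (hL : ∀ δ ≤ K, ∀ u ∈ L δ, ∀ w ∈ L δ, S.near u w → u = w) :
    iidLaw V (iidLaw ℕ ν)
      {X | ∀ δ ≤ K, ∀ w ∈ L δ, S.bad (fun x => X x (S.above K L δ x)) w} ≤
      ∏ δ ∈ Finset.range (K + 1), p ^ (L δ).card := by
  classical
  let g : (Σ j : (Σ δ : Fin (K + 1), L δ), S.vbl j.2) → V × ℕ :=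
    fun q => (q.2, S.above K L q.1.1 q.2)
  have habove : ∀ {δ δ' : Fin (K + 1)} {w : V} {x : V}, w ∈ L δ' → x ∈ S.vbl w → δ < δ' →
      S.above K L δ' x < S.above K L δ x := by
    intro δ δ' w x hw hx hlt
    refine Finset.card_lt_card ⟨fun e he => ?_, fun hsub => ?_⟩
    · rw [Finset.mem_filter] at he ⊢
      exact ⟨he.1, lt_trans (show (δ : ℕ) < δ' from hlt) he.2.1, he.2.2⟩
    · have : (δ' : ℕ) ∈ (Finset.range (K + 1)).filter
          fun e => (δ' : ℕ) < e ∧ ∃ u ∈ L e, x ∈ S.vbl u :=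
        hsub (Finset.mem_filter.mpr ⟨Finset.mem_range.mpr δ'.2, hlt, w, hw, hx⟩)
      exact lt_irrefl _ (Finset.mem_filter.mp this).2.1
  have hg : Function.Injective g := by
    rintro ⟨⟨δ, w, hw⟩, x, hx⟩ ⟨⟨δ', w', hw'⟩, x', hx'⟩ h
    simp only [g, Prod.mk.injEq] at h
    obtain ⟨rfl, h⟩ := h
    rcases lt_trichotomy δ δ' with hlt | rfl | hgt
    · exact absurd h (habove hw' hx' hlt).ne'
    · have := hL δ (Nat.lt_succ_iff.mp δ.2) w hw w' hw' (S.near_of_mem hx hx')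
      subst this
      rfl
    · exact absurd h (habove hw hx hgt).ne
  let Q : ∀ j : (Σ δ : Fin (K + 1), L δ), Set (S.vbl j.2 → Y) :=
    fun j => {z | ∃ y : V → Y, (∀ x : S.vbl j.2, y x = z x) ∧ S.bad y j.2}
  have hQ : ∀ j, iidLaw (S.vbl j.2) ν (Q j) ≤ p := by
    intro j
    rw [← (measurePreserving_iidLaw_comp ν (Subtype.val_injective (p := (· ∈ S.vbl j.2)))
      ).measure_preimage (Set.toFinite (Q j)).measurableSet.nullMeasurableSet]
    refine (measure_mono ?_).trans (hp j.2)
    rintro y ⟨y', h, hbad⟩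
    exact S.bad_congr (fun x hx => h ⟨x, hx⟩) hbad
  calc iidLaw V (iidLaw ℕ ν) {X | ∀ δ ≤ K, ∀ w ∈ L δ, S.bad (fun x => X x (S.above K L δ x)) w}
      ≤ iidLaw V (iidLaw ℕ ν) ((fun (X : V → ℕ → Y) (q : V × ℕ) => X q.1 q.2) ⁻¹'
          {T | ∀ j, (fun x => T (g ⟨j, x⟩)) ∈ Q j}) := by
        refine measure_mono fun X hX => ?_
        rintro ⟨δ, w, hw⟩
        exact ⟨_, fun x => rfl, hX δ (Nat.lt_succ_iff.mp δ.2) w hw⟩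
    _ = iidLaw (V × ℕ) ν {T | ∀ j, (fun x => T (g ⟨j, x⟩)) ∈ Q j} := by
        refine (measurePreserving_iidLaw_uncurry ν).measure_preimage ?_
        rw [Set.ofPred_forall]
        refine MeasurableSet.nullMeasurableSet (MeasurableSet.iInter fun j => ?_)
        exact (Set.toFinite (Q j)).measurableSet.preimage (by fun_prop)
    _ = ∏ j, iidLaw (S.vbl j.2) ν (Q j) := iidLaw_forall_mem_of_disjoint ν hg Q
    _ ≤ ∏ j : (Σ δ : Fin (K + 1), L δ), p := Finset.prod_le_prod' fun j _ => hQ j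
    _ = ∏ δ ∈ Finset.range (K + 1), p ^ (L δ).card := by
        rw [Fintype.prod_sigma, ← Fin.prod_univ_eq_prod_range (fun δ => p ^ (L δ).card)]
        simp

/-- A distributed local lemma: after `K` iterations of parallel resampling no bad event is left,
except with probability `2⁻¹ ^ K` per event. The bound is uniform in the identifiers. -/
theorem measure_exists_bad_le {p : ENNReal} (hp : ∀ w, iidLaw V ν {y | S.bad y w} ≤ p)
    {d : ℕ} (hd : ∀ w, {u | S.rel w u}.ncard ≤ d) (hpd : (1 + 4 * p) ^ d ≤ 2)
    (hp2 : p * 2 ≤ 1) (K : ℕ) :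
    iidLaw V (iidLaw ℕ ν) {X | ∃ id : V → J, Function.Injective id ∧
      ∃ v, S.bad (S.current id X K) v} ≤ Fintype.card V * 2⁻¹ ^ K := by
  classical
  let C (v : V) : Finset (ℕ → Finset V) := (S.chains K {v}).filter
    fun L => ∀ δ ≤ K, ∀ u ∈ L δ, ∀ w ∈ L δ, S.near u w → u = w
  let W (L : ℕ → Finset V) : Set (V → ℕ → Y) :=
    {X | ∀ δ ≤ K, ∀ w ∈ L δ, S.bad (fun x => X x (S.above K L δ x)) w}
  have hsub : {X : V → ℕ → Y | ∃ id : V → J, Function.Injective id ∧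
      ∃ v, S.bad (S.current id X K) v} ⊆ ⋃ v ∈ Finset.univ, ⋃ L ∈ C v, W L := by
    rintro X ⟨id, hid, u, hu⟩
    obtain ⟨v, hv⟩ := exists_selected_of_bad (id := id) hu
    let sel : ℕ → V → Prop := fun i => S.selected id (S.current id X i)
    have hsel : ∀ i u v, sel i u → sel i v → S.near u v → u = v :=
      fun i u v hu hv h => eq_of_selected_of_near hid hu hv h
    have hchain : ∀ i v, sel (i + 1) v → ∃ u, sel i u ∧ S.rel v u :=
      fun i v h => exists_selected_rel h
    simp only [Set.mem_iUnion]
    refine ⟨v, Finset.mem_univ v, S.level sel K v, Finset.mem_filter.mpr ⟨?_, ?_⟩, ?_⟩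
    · refine mem_chains level_zero (fun δ hδ => ⟨level_nonempty hv hchain hδ, fun w hw => ?_⟩)
        fun δ hδ => level_eq_empty hδ
      simpa [hull] using exists_rel_of_mem_level_succ hw
    · exact fun δ _ u hu w hw hn => eq_of_mem_level_of_near hv hsel hu hw hn
    · intro δ _ w hw
      obtain ⟨m, hm, hadd, hh⟩ := mem_level.mp hw
      refine S.bad_congr (fun x hx => ?_) (sel_of_added (sel := sel) hv hadd).1
      rw [← card_resampled_eq_above hv hsel hm hadd hh hx, current, counter_eq_card]
      congr!
  calc iidLaw V (iidLaw ℕ ν) {X | ∃ id : V → J, Function.Injective id ∧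
        ∃ v, S.bad (S.current id X K) v}
      ≤ ∑ v : V, ∑ L ∈ C v, iidLaw V (iidLaw ℕ ν) (W L) := by
        refine (measure_mono hsub).trans ((measure_biUnion_finset_le _ _).trans ?_)
        exact Finset.sum_le_sum fun v _ => measure_biUnion_finset_le _ _
    _ ≤ ∑ v : V, ∑ L ∈ C v, ∏ δ ∈ Finset.range (K + 1), p ^ (L δ).card := by
        refine Finset.sum_le_sum fun v _ => Finset.sum_le_sum fun L hL => ?_
        exact measure_forall_bad_le ν hp (Finset.mem_filter.mp hL).2
    _ ≤ ∑ v : V, ∑ L ∈ S.chains K {v}, ∏ δ ∈ Finset.range (K + 1), p ^ (L δ).card :=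
        Finset.sum_le_sum fun v _ => Finset.sum_le_sum_of_subset (Finset.filter_subset _ _)
    _ ≤ ∑ v : V, 2⁻¹ ^ K := by
        refine Finset.sum_le_sum fun v _ => (sum_chains_le hd hpd K {v}).trans ?_
        rw [Finset.card_singleton, pow_one, pow_one, mul_left_comm]
        exact mul_le_of_le_one_right zero_le hp2
    _ = Fintype.card V * 2⁻¹ ^ K := by simp

end Measure

end EventSystem

/-! ### Replacing infinite random strings by finitely many -/

section Collision

variable {ι Y : Type*} [Fintype ι] [MeasurableSpace Y] [MeasurableSingletonClass Y] [Finite Y]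
  (ν : Measure Y) [IsProbabilityMeasure ν]

lemma iidLaw_not_injective_le {c : ENNReal} (hc : ∀ y, ν {y} ≤ c) :
    iidLaw ι ν {z | ¬ Function.Injective z} ≤ (Fintype.card ι : ENNReal) ^ 2 * c := by
  classical
  have hpair : ∀ a b : ι, a ≠ b → iidLaw ι ν {z | z a = z b} ≤ c := by
    intro a b hab
    have h := Measure.infinitePi_map_eval_prod (P := fun _ : ι => ν) hab
    have hm : MeasurableSet {q : Y × Y | q.1 = q.2} := (Set.toFinite _).measurableSet
    calc iidLaw ι ν {z | z a = z b}
        = (iidLaw ι ν).map (fun z => (z a, z b)) {q : Y × Y | q.1 = q.2} := by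
          rw [Measure.map_apply (by fun_prop) hm]; rfl
      _ = (ν.prod ν) {q : Y × Y | q.1 = q.2} := by rw [iidLaw, h]
      _ = ∫⁻ y, ν {y} ∂ν := by
          rw [Measure.prod_apply hm]
          congr! with y
          ext y'; simp [eq_comm]
      _ ≤ ∫⁻ _, c ∂ν := lintegral_mono hc
      _ = c := by simp
  calc iidLaw ι ν {z | ¬ Function.Injective z}
      ≤ iidLaw ι ν (⋃ q ∈ (Finset.univ.filter fun q : ι × ι => q.1 ≠ q.2),
          {z | z q.1 = z q.2}) := by
        refine measure_mono fun z hz => ?_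
        simp only [Function.Injective, Set.mem_ofPred_eq] at hz
        push Not at hz
        obtain ⟨a, b, h, hab⟩ := hz
        simp only [Set.mem_iUnion]
        exact ⟨(a, b), by simpa using hab, h⟩
    _ ≤ ∑ q ∈ (Finset.univ.filter fun q : ι × ι => q.1 ≠ q.2), iidLaw ι ν {z | z q.1 = z q.2} :=
        measure_biUnion_finset_le _ _
    _ ≤ ∑ q ∈ (Finset.univ.filter fun q : ι × ι => q.1 ≠ q.2), c :=
        Finset.sum_le_sum fun q hq => hpair _ _ (Finset.mem_filter.mp hq).2
    _ ≤ ∑ q : ι × ι, c := Finset.sum_le_sum_of_subset (Finset.filter_subset _ _)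
    _ = (Fintype.card ι : ENNReal) ^ 2 * c := by simp [sq]

end Collision

section Palette

variable {W X Y : Type*} [Fintype W] [MeasurableSpace X] (β : Measure X) [IsProbabilityMeasure β]
  [MeasurableSpace Y] [MeasurableSingletonClass Y] [Finite Y] (ν : Measure Y)
  [IsProbabilityMeasure ν]

/-- The `j`-th moment, over a random palette `e`, of the probability that colors drawn from the
palette satisfy `F`. Unless two of the `j` draws share a color, they are independent. -/
lemma lintegral_palette_pow_le {F : Set (W → X)} (hF : MeasurableSet F) {q : ENNReal}
    (hq : iidLaw W β F ≤ q) {c : ENNReal} (hc : ∀ y, ν {y} ≤ c) (j : ℕ) :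
    ∫⁻ e, iidLaw W ν {y | (fun w => e (y w)) ∈ F} ^ j ∂(iidLaw Y β) ≤
      (j * Fintype.card W : ENNReal) ^ 2 * c + q ^ j := by
  classical
  let Z : Set ((Y → X) × (Fin j → W → Y)) := {s | ∀ a, (fun w => s.1 (s.2 a w)) ∈ F}
  have hZ : MeasurableSet Z := by
    have h1 : Measurable fun s : (Y → X) × Y => s.1 s.2 :=
      measurable_from_prod_countable_left fun y => measurable_pi_apply y
    simp only [Z]
    rw [Set.ofPred_forall]
    refine MeasurableSet.iInter fun a => hF.preimage ?_
    refine measurable_pi_lambda _ fun w => h1.comp (f := fun s : (Y → X) × (Fin j → W → Y) =>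
      (s.1, s.2 a w)) (by fun_prop)
  have h₁ : ((iidLaw Y β).prod (iidLaw (Fin j) (iidLaw W ν))) Z =
      ∫⁻ e, iidLaw W ν {y | (fun w => e (y w)) ∈ F} ^ j ∂(iidLaw Y β) := by
    rw [Measure.prod_apply hZ]
    refine lintegral_congr fun e => ?_
    have := iidLaw_forall_mem (ι := Fin j) (iidLaw W ν) fun _ => {y | (fun w => e (y w)) ∈ F}
    rw [Finset.prod_const, Finset.card_univ, Fintype.card_fin] at this
    exact this
  rw [← h₁, Measure.prod_apply_symm hZ]
  have hslice : ∀ z : Fin j → W → Y, iidLaw Y β ((fun e => (e, z)) ⁻¹' Z) ≤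
      Set.indicator {z | ¬ Function.Injective fun p : Fin j × W => z p.1 p.2} 1 z + q ^ j := by
    intro z
    by_cases hz : Function.Injective fun p : Fin j × W => z p.1 p.2
    · refine le_add_left ?_
      have hmp := (measurePreserving_iidLaw_curry (ι := Fin j) (κ := W) β).comp
        (measurePreserving_iidLaw_comp β hz)
      have hm : MeasurableSet {f : Fin j → W → X | ∀ a, f a ∈ F} := by
        rw [Set.ofPred_forall]
        exact MeasurableSet.iInter fun a => hF.preimage (measurable_pi_apply a)
      calc iidLaw Y β ((fun e => (e, z)) ⁻¹' Z)
          = iidLaw (Fin j) (iidLaw W β) {f | ∀ a, f a ∈ F} :=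
            hmp.measure_preimage hm.nullMeasurableSet
        _ = iidLaw W β F ^ j := by
            rw [iidLaw_forall_mem (iidLaw W β) fun _ => F]; simp
        _ ≤ q ^ j := by gcongr
    · refine le_add_right ?_
      rw [Set.indicator_of_mem (by exact hz)]
      exact prob_le_one
  refine (lintegral_mono hslice).trans ?_
  rw [lintegral_add_right _ measurable_const,
    lintegral_indicator_one (Set.toFinite _).measurableSet,
    lintegral_const, measure_univ, mul_one]
  gcongr
  have hm : MeasurableSet {z : Fin j × W → Y | ¬ Function.Injective z} :=
    (Set.toFinite _).measurableSet
  calc iidLaw (Fin j) (iidLaw W ν) {z | ¬ Function.Injective fun p : Fin j × W => z p.1 p.2}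
      = iidLaw (Fin j × W) ν {z | ¬ Function.Injective z} :=
        (measurePreserving_iidLaw_uncurry ν).measure_preimage hm.nullMeasurableSet
    _ ≤ (Fintype.card (Fin j × W) : ENNReal) ^ 2 * c := iidLaw_not_injective_le ν hc
    _ = (j * Fintype.card W : ENNReal) ^ 2 * c := by simp

end Palette

/-- Finitely many infinite random strings suffice: there is a palette of `2 ^ k` strings such that,
when every coordinate picks a string of the palette independently and uniformly, each of finitely
many given events has at most twice its original probability. -/
theorem exists_palette {ι W X : Type*} [Finite ι] [Fintype W] [MeasurableSpace X] (β : Measure X)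
    [IsProbabilityMeasure β] {F : ι → Set (W → X)} (hF : ∀ i, MeasurableSet (F i)) {q : ENNReal}
    (hq0 : q ≠ 0) (hqt : q ≠ ⊤) (hq : ∀ i, iidLaw W β (F i) ≤ q) :
    ∃ (k : ℕ) (e : (Fin k → Bool) → X),
      ∀ i, iidLaw W (iidLaw (Fin k) coin) {y | (fun w => e (y w)) ∈ F i} ≤ 2 * q := by
  classical
  have := Fintype.ofFinite ι
  set N : ENNReal := (Fintype.card ι : ENNReal) with hN
  have hNt : N ≠ ⊤ := ENNReal.natCast_ne_top _
  have hpow : Tendsto (fun n : ℕ => (2⁻¹ : ENNReal) ^ n) atTop (nhds 0) :=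
    ENNReal.tendsto_pow_atTop_nhds_zero_of_lt_one (by simp)
  -- `j` makes the moment of independent draws small, and then `k` makes collisions unlikely
  obtain ⟨j, hj⟩ : ∃ j : ℕ, N * 2⁻¹ ^ j < 2⁻¹ := by
    have h := ENNReal.Tendsto.const_mul (a := N) hpow (Or.inr hNt)
    rw [mul_zero] at h
    exact (h.eventually_lt_const (by simp)).exists
  have hQ0 : (2 * q) ^ j ≠ 0 := pow_ne_zero _ (by simpa using hq0)
  have hQt : (2 * q) ^ j ≠ ⊤ := ENNReal.pow_ne_top (ENNReal.mul_ne_top (by simp) hqt)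
  obtain ⟨k, hk⟩ : ∃ k : ℕ,
      N * ((j * Fintype.card W : ENNReal) ^ 2 / (2 * q) ^ j) * 2⁻¹ ^ k < 2⁻¹ := by
    have h := ENNReal.Tendsto.const_mul
      (a := N * ((j * Fintype.card W : ENNReal) ^ 2 / (2 * q) ^ j)) hpow (Or.inr ?_)
    · rw [mul_zero] at h
      exact (h.eventually_lt_const (by simp)).exists
    · exact ENNReal.mul_ne_top hNt (ENNReal.div_ne_top (by finiteness) hQ0)
  refine ⟨k, ?_⟩
  set ν := iidLaw (Fin k) coin
  have hc : ∀ y, ν {y} ≤ 2⁻¹ ^ k := fun y => by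
    simp [ν, iidLaw_coin_singleton]
  by_contra! hne
  let f (i : ι) (e : (Fin k → Bool) → X) : ENNReal := iidLaw W ν {y | (fun w => e (y w)) ∈ F i}
  -- Markov's inequality for the `j`-th moment
  have hmarkov : ∀ i, iidLaw (Fin k → Bool) β {e | 2 * q < f i e} ≤
      ((j * Fintype.card W : ENNReal) ^ 2 * 2⁻¹ ^ k + q ^ j) / (2 * q) ^ j := by
    intro i
    have h1 : {e | 2 * q < f i e} ⊆ {e | (2 * q) ^ j ≤ f i e ^ j} := by
      intro e he
      exact pow_le_pow_left₀ zero_le (le_of_lt (show 2 * q < f i e from he)) j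
    refine (measure_mono h1).trans ?_
    refine (meas_ge_le_lintegral_div ?_ hQ0 hQt).trans ?_
    · refine Measurable.aemeasurable (Measurable.pow_const ?_ j)
      have h2 : f i = fun e => ∑ y : W → Fin k → Bool,
          (Set.indicator {e | (fun w => e (y w)) ∈ F i} (fun _ => iidLaw W ν {y}) e) := by
        funext e
        rw [show f i e = iidLaw W ν (⋃ y ∈ (Finset.univ : Finset (W → Fin k → Bool)),
            (if (fun w => e (y w)) ∈ F i then {y} else ∅)) by
          simp only [f]; congr 1; ext y; simp]
        rw [measure_biUnion_finset]
        · refine Finset.sum_congr rfl fun y _ => ?_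
          by_cases h : (fun w => e (y w)) ∈ F i
          · rw [if_pos h, Set.indicator_of_mem (by exact h)]
          · rw [if_neg h, Set.indicator_of_notMem (by exact h), measure_empty]
        · intro y _ y' _ hyy
          rw [Function.onFun, Set.disjoint_left]
          intro u hu hu'
          split_ifs at hu hu' <;> simp_all
        · exact fun y _ => (Set.toFinite _).measurableSet
      rw [h2]
      refine Finset.measurable_sum _ fun y _ => measurable_const.indicator ?_
      exact (hF i).preimage (by fun_prop)
    · gcongr
      exact lintegral_palette_pow_le β ν (hF i) (hq i) hc j
  have hone : (1 : ENNReal) ≤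
      N * (((j * Fintype.card W : ENNReal) ^ 2 * 2⁻¹ ^ k + q ^ j) / (2 * q) ^ j) := by
    calc (1 : ENNReal) = iidLaw (Fin k → Bool) β Set.univ := measure_univ.symm
      _ ≤ iidLaw (Fin k → Bool) β (⋃ i, {e | 2 * q < f i e}) := by
          refine measure_mono fun e _ => ?_
          obtain ⟨i, hi⟩ := hne e
          exact Set.mem_iUnion.mpr ⟨i, hi⟩
      _ ≤ ∑ i, iidLaw (Fin k → Bool) β {e | 2 * q < f i e} := measure_iUnion_fintype_le _ _
      _ ≤ ∑ i : ι, ((j * Fintype.card W : ENNReal) ^ 2 * 2⁻¹ ^ k + q ^ j) / (2 * q) ^ j :=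
          Finset.sum_le_sum fun i _ => hmarkov i
      _ = _ := by simp [hN]
  refine absurd hone (not_le.mpr ?_)
  have hqq : q ^ j / (2 * q) ^ j = 2⁻¹ ^ j := by
    rw [mul_pow, ENNReal.div_eq_inv_mul, ENNReal.mul_inv (by simp) (by simp), mul_assoc,
      ENNReal.inv_mul_cancel (pow_ne_zero _ hq0) (ENNReal.pow_ne_top hqt), mul_one,
      ENNReal.inv_pow]
  calc N * (((j * Fintype.card W : ENNReal) ^ 2 * 2⁻¹ ^ k + q ^ j) / (2 * q) ^ j)
      = N * ((j * Fintype.card W : ENNReal) ^ 2 / (2 * q) ^ j) * 2⁻¹ ^ k + N * 2⁻¹ ^ j := by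
        rw [ENNReal.add_div, hqq, mul_add, ENNReal.div_eq_inv_mul, ENNReal.div_eq_inv_mul]
        ring
    _ < 2⁻¹ + 2⁻¹ := ENNReal.add_lt_add hk hj
    _ = 1 := ENNReal.inv_two_add_inv_two

/-! ### Distances -/

namespace SimpleGraph

variable {V : Type*} {G : SimpleGraph V}

lemma edist_le_zero_iff {v u : V} : G.edist v u ≤ (0 : ℕ) ↔ v = u := by
  rw [Nat.cast_zero, nonpos_iff_eq_zero, edist_eq_zero_iff]

lemma edist_le_of_adj {v u x : V} {s : ℕ} (h : G.edist v u ≤ s) (hux : G.Adj u x) :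
    G.edist v x ≤ (s + 1 : ℕ) := by
  refine (G.edist_triangle (v := u)).trans ?_
  rw [edist_eq_one_iff_adj.mpr hux, Nat.cast_add, Nat.cast_one]
  gcongr

lemma edist_le_add {v u x : V} {s t : ℕ} (h : G.edist v u ≤ s) (h' : G.edist u x ≤ t) :
    G.edist v x ≤ (s + t : ℕ) := by
  refine (G.edist_triangle (v := u)).trans ?_
  rw [Nat.cast_add]
  gcongr

lemma edist_le_mono {v u : V} {s t : ℕ} (h : G.edist v u ≤ s) (hst : s ≤ t) : G.edist v u ≤ t :=
  h.trans (by exact_mod_cast hst)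

lemma eq_or_exists_adj_of_edist_le_succ {v u : V} {s : ℕ} (h : G.edist v u ≤ (s + 1 : ℕ)) :
    v = u ∨ ∃ x, G.edist v x ≤ s ∧ G.Adj x u := by
  rw [edist_comm] at h
  obtain ⟨p, hp⟩ := exists_walk_of_edist_ne_top (ne_top_of_le_ne_top (ENat.natCast_ne_top _) h)
  rw [← hp] at h
  cases p with
  | nil => exact Or.inl rfl
  | cons hadj q =>
    refine Or.inr ⟨_, ?_, hadj.symm⟩
    rw [edist_comm]
    refine (edist_le q).trans ?_
    rw [Walk.length_cons] at h
    have h' : q.length + 1 ≤ s + 1 := by exact_mod_cast h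
    exact_mod_cast (by omega : q.length ≤ s)

end SimpleGraph

open SimpleGraph (edist_le_zero_iff edist_le_of_adj edist_le_add edist_le_mono
  eq_or_exists_adj_of_edist_le_succ)

namespace Configuration

variable {W₁ W₂ W₃ Inp Out : Type} {C₁ : Configuration W₁ Inp Out} {C₂ : Configuration W₂ Inp Out}
  {C₃ : Configuration W₃ Inp Out}

lemma Isomorphic.symm (h : C₁.Isomorphic C₂) : C₂.Isomorphic C₁ := by
  obtain ⟨e, hc, hd, hp, hi, ho⟩ := h
  refine ⟨e.symm, ?_, ?_, ?_, ?_, ?_⟩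
  · rw [← hc]; exact e.symm_apply_apply _
  · intro a; rw [← hd, e.apply_symm_apply]
  · intro a b hab
    rw [← hp]
    congr 1 <;> exact e.apply_symm_apply _
  · intro a; rw [← hi, e.apply_symm_apply]
  · intro a; rw [← ho, e.apply_symm_apply]

lemma Isomorphic.trans (h : C₁.Isomorphic C₂) (h' : C₂.Isomorphic C₃) : C₁.Isomorphic C₃ := by
  obtain ⟨e, hc, hd, hp, hi, ho⟩ := h
  obtain ⟨e', hc', hd', hp', hi', ho'⟩ := h'
  refine ⟨e.trans e', ?_, ?_, ?_, ?_, ?_⟩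
  · exact (congrArg e' hc).trans hc'
  · exact fun a => (hd' _).trans (hd a)
  · exact fun a b hab => (hp' _ _ _).trans (hp a b hab)
  · exact fun a => (hi' _).trans (hi a)
  · exact fun a => (ho' _).trans (ho a)

end Configuration

/-! ### Networks that look alike around a vertex -/

namespace Network

variable {V V' Inp Out Msg : Type}

/-- `φ` identifies what the network `N` looks like within distance `R` of `v` with what `N'` looks
like around `φ v`. Edges between two vertices at distance `R` from `v` are not compared. -/
structure LocalIso (N : Network V Inp) (N' : Network V' Inp) (R : ℕ) (v : V) (φ : V → V') :
    Prop where
  deg_eq : ∀ u, N.graph.edist v u ≤ R → N'.deg (φ u) = N.deg u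
  input_eq : ∀ u, N.graph.edist v u ≤ R → N'.input (φ u) = N.input u
  injOn : ∀ u x, N.graph.edist v u ≤ R → N.graph.edist v x ≤ R → φ u = φ x → u = x
  adj : ∀ u x (h : N.graph.Adj u x) (s : ℕ), N.graph.edist v u ≤ s → s + 1 ≤ R →
    ∃ h' : N'.graph.Adj (φ u) (φ x),
      (N'.port (φ u) ⟨φ x, h'⟩ : ℕ) = N.port u ⟨x, h⟩ ∧
      (N'.port (φ x) ⟨φ u, h'.symm⟩ : ℕ) = N.port x ⟨u, h.symm⟩

namespace LocalIso

variable {N : Network V Inp} {N' : Network V' Inp} {R : ℕ} {v : V} {φ : V → V'}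

protected lemma id (N : Network V Inp) (R : ℕ) (v : V) : LocalIso N N R v id where
  deg_eq _ _ := rfl
  input_eq _ _ := rfl
  injOn _ _ _ _ h := h
  adj _ _ h _ _ _ := ⟨h, rfl, rfl⟩

lemma recenter (h : LocalIso N N' R v φ) {u : V} {s R' : ℕ} (hu : N.graph.edist v u ≤ s)
    (hR : s + R' ≤ R) : LocalIso N N' R' u φ where
  deg_eq x hx := h.deg_eq x (edist_le_mono (edist_le_add hu hx) hR)
  input_eq x hx := h.input_eq x (edist_le_mono (edist_le_add hu hx) hR)
  injOn x y hx hy := h.injOn x y (edist_le_mono (edist_le_add hu hx) hR)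
    (edist_le_mono (edist_le_add hu hy) hR)
  adj x y hxy t hx ht := h.adj x y hxy (s + t) (edist_le_add hu hx) (by omega)

lemma exists_adj (h : LocalIso N N' R v φ) {u : V} {s : ℕ} (hu : N.graph.edist v u ≤ s)
    (hs : s + 1 ≤ R) {a : V'} (ha : N'.graph.Adj (φ u) a) : ∃ x, N.graph.Adj u x ∧ φ x = a := by
  have hd := h.deg_eq u (edist_le_mono hu (by omega))
  let x := (N.port u).symm (Fin.cast hd (N'.port (φ u) ⟨a, ha⟩))
  refine ⟨x, x.2, ?_⟩
  obtain ⟨h', hp, -⟩ := h.adj u x x.2 s hu hs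
  have heq : N'.port (φ u) ⟨φ x, h'⟩ = N'.port (φ u) ⟨a, ha⟩ := by
    ext
    rw [hp]
    simp [x]
  exact congrArg Subtype.val ((N'.port (φ u)).injective heq)

lemma edist_le (h : LocalIso N N' R v φ) {s : ℕ} (hs : s ≤ R) {u : V}
    (hu : N.graph.edist v u ≤ s) : N'.graph.edist (φ v) (φ u) ≤ s := by
  induction s generalizing u with
  | zero =>
    rw [edist_le_zero_iff] at hu ⊢
    rw [hu]
  | succ s ih =>
    obtain rfl | ⟨x, hx, hadj⟩ := eq_or_exists_adj_of_edist_le_succ hu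
    · rw [SimpleGraph.edist_self]; exact zero_le
    · obtain ⟨h', -⟩ := h.adj x u hadj s hx hs
      exact edist_le_of_adj (ih (by omega) hx) h'

lemma exists_of_edist_le (h : LocalIso N N' R v φ) {s : ℕ} (hs : s ≤ R) {a : V'}
    (ha : N'.graph.edist (φ v) a ≤ s) : ∃ u, N.graph.edist v u ≤ s ∧ φ u = a := by
  induction s generalizing a with
  | zero => exact ⟨v, by simp, edist_le_zero_iff.mp ha⟩
  | succ s ih =>
    obtain rfl | ⟨b, hb, hadj⟩ := eq_or_exists_adj_of_edist_le_succ ha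
    · exact ⟨v, by simp, rfl⟩
    · obtain ⟨u, hu, rfl⟩ := ih (by omega) hb
      obtain ⟨x, hx, rfl⟩ := h.exists_adj hu hs hadj
      exact ⟨x, edist_le_of_adj hu hx, rfl⟩

lemma adj_iff (h : LocalIso N N' R v φ) {u x : V} {s : ℕ} (hu : N.graph.edist v u ≤ s)
    (hs : s + 1 ≤ R) (hx : N.graph.edist v x ≤ R) :
    N'.graph.Adj (φ u) (φ x) ↔ N.graph.Adj u x := by
  refine ⟨fun h' => ?_, fun hadj => (h.adj u x hadj s hu hs).1⟩
  obtain ⟨y, hy, hyx⟩ := h.exists_adj hu hs h'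
  rwa [h.injOn y x (edist_le_mono (edist_le_of_adj hu hy) hs) hx hyx] at hy

/-- The margin of `1` is needed for the edges between two vertices on the boundary of the ball. -/
lemma ball_isomorphic (h : LocalIso N N' R v φ) {r : ℕ} (hr : r + 1 ≤ R) {out : V → Out}
    {out' : V' → Out} (hout : ∀ u, N.graph.edist v u ≤ r → out' (φ u) = out u) :
    (N.ball out r v).Isomorphic (N'.ball out' r (φ v)) := by
  let f : {u : V // N.graph.edist v u ≤ r} → {a : V' // N'.graph.edist (φ v) a ≤ r} :=
    fun u => ⟨φ u, h.edist_le (by omega) u.2⟩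
  have hf : Function.Bijective f := by
    constructor
    · intro u x hux
      exact Subtype.ext (h.injOn u x (edist_le_mono u.2 (by omega))
        (edist_le_mono x.2 (by omega)) (congrArg Subtype.val hux))
    · rintro ⟨a, ha⟩
      obtain ⟨u, hu, rfl⟩ := h.exists_of_edist_le (by omega) ha
      exact ⟨⟨u, hu⟩, rfl⟩
  refine ⟨⟨Equiv.ofBijective f hf, ?_⟩, rfl, ?_, ?_, ?_, ?_⟩
  · intro u x
    exact h.adj_iff u.2 hr (edist_le_mono x.2 (by omega))
  · exact fun u => h.deg_eq u (edist_le_mono u.2 (by omega))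
  · intro u x hux
    exact (h.adj u x hux r u.2 hr).2.1
  · exact fun u => h.input_eq u (edist_le_mono u.2 (by omega))
  · exact fun u => hout u u.2

end LocalIso

end Network

/-! ### Local algorithms see only their neighborhood -/

namespace RandLocalAlgorithm

variable {V V' Inp Out Msg : Type} (A : RandLocalAlgorithm Inp Out Msg)

lemma receive_congr {d d' : ℕ} (hd : d' = d) {s s' : A.State} (hs : s' = s) {m : Fin d → Msg}
    {m' : Fin d' → Msg} (hm : ∀ i, m' i = m (Fin.cast hd i)) :
    A.receive d' s' m' = A.receive d s m := by
  subst hd hs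
  exact congrArg _ (funext hm)

lemma send_congr {d d' : ℕ} (hd : d' = d) {s s' : A.State} (hs : s' = s) {i : Fin d} {i' : Fin d'}
    (hi : (i' : ℕ) = i) : A.send d' s' i' = A.send d s i := by
  subst hd hs
  exact congrArg _ (Fin.ext hi)

/-- The states after `j` rounds when the vertices are told that the network has `n` vertices. -/
def stateAt (n : ℕ) (N : Network V Inp) (ω : V → ℕ → Bool) (j : ℕ) : V → A.State :=
  (A.step N)^[j] fun u => A.init n (N.deg u) (N.input u) (ω u)

/-- The output labeling when the vertices are told that the network has `n` vertices. -/
def runAt (n : ℕ) (N : Network V Inp) (ω : V → ℕ → Bool) : V → Out :=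
  fun v => A.output (A.stateAt n N ω (A.rounds n) v)

lemma run_eq_runAt [Fintype V] (N : Network V Inp) : A.run N = A.runAt (Fintype.card V) N := rfl

lemma stateAt_succ (n : ℕ) (N : Network V Inp) (ω : V → ℕ → Bool) (j : ℕ) :
    A.stateAt n N ω (j + 1) = A.step N (A.stateAt n N ω j) :=
  Function.iterate_succ_apply' _ _ _

variable {N : Network V Inp} {N' : Network V' Inp} {R : ℕ} {v : V} {φ : V → V'}
  {ω : V → ℕ → Bool} {ω' : V' → ℕ → Bool}

lemma stateAt_eq_of_localIso (h : N.LocalIso N' R v φ)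
    (hω : ∀ u, N.graph.edist v u ≤ R → ω' (φ u) = ω u) (n : ℕ) {j s : ℕ} (hs : s + j ≤ R) {u : V}
    (hu : N.graph.edist v u ≤ s) : A.stateAt n N' ω' j (φ u) = A.stateAt n N ω j u := by
  induction j generalizing s u with
  | zero =>
    have hu' := edist_le_mono hu hs
    simp only [stateAt, Function.iterate_zero, id_eq, h.deg_eq u hu', h.input_eq u hu', hω u hu']
  | succ j ih =>
    rw [stateAt_succ, stateAt_succ]
    have hd := h.deg_eq u (edist_le_mono hu (by omega))
    refine A.receive_congr hd (ih (by omega) hu) fun i => ?_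
    set x := (N.port u).symm (Fin.cast hd i) with hx
    obtain ⟨h', hp, hp'⟩ := h.adj u x x.2 s hu (by omega)
    have hx' : (N'.port (φ u)).symm i = ⟨φ x, h'⟩ := by
      rw [Equiv.symm_apply_eq]
      ext
      rw [hp]
      simp [hx]
    have hxs := edist_le_of_adj hu x.2
    have key : ∀ z : N'.graph.neighborSet (φ u), z = ⟨φ x, h'⟩ →
        A.send (N'.deg z) (A.stateAt n N' ω' j z) (N'.port z ⟨φ u, N'.graph.adj_symm z.2⟩) =
          A.send (N.deg x) (A.stateAt n N ω j x) (N.port x ⟨u, N.graph.adj_symm x.2⟩) := by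
      rintro _ rfl
      exact A.send_congr (h.deg_eq x (edist_le_mono hxs (by omega))) (ih (by omega) hxs) hp'
    exact key _ hx'

lemma runAt_eq_of_localIso (h : N.LocalIso N' R v φ)
    (hω : ∀ u, N.graph.edist v u ≤ R → ω' (φ u) = ω u) {n s : ℕ} (hs : s + A.rounds n ≤ R) {u : V}
    (hu : N.graph.edist v u ≤ s) : A.runAt n N' ω' (φ u) = A.runAt n N ω u :=
  congrArg A.output (A.stateAt_eq_of_localIso h hω n hs hu)

end RandLocalAlgorithm

/-- The output labeling `out` violates the problem `P` at the vertex `v`. -/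
def LCL.Violated {V Inp Out : Type} (P : LCL Inp Out) (N : Network V Inp) (out : V → Out)
    (v : V) : Prop :=
  ¬ ∃ C ∈ P.accept, (N.ball out P.radius v).Isomorphic C.2

lemma LCL.correct_iff {V Inp Out : Type} (P : LCL Inp Out) (N : Network V Inp) (out : V → Out) :
    P.Correct N out ↔ ∀ v, ¬ P.Violated N out v := by
  simp [LCL.Correct, LCL.Violated]

lemma LCL.violated_runAt_iff_of_localIso {V V' Inp Out Msg : Type} (P : LCL Inp Out)
    (A : RandLocalAlgorithm Inp Out Msg) {N : Network V Inp} {N' : Network V' Inp} {R : ℕ} {v : V}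
    {φ : V → V'} {ω : V → ℕ → Bool} {ω' : V' → ℕ → Bool} (h : N.LocalIso N' R v φ)
    (hω : ∀ u, N.graph.edist v u ≤ R → ω' (φ u) = ω u) {n : ℕ}
    (hR : P.radius + A.rounds n + 1 ≤ R) :
    P.Violated N' (A.runAt n N' ω') (φ v) ↔ P.Violated N (A.runAt n N ω) v := by
  have hiso := h.ball_isomorphic (r := P.radius) (by omega)
    (out := A.runAt n N ω) (out' := A.runAt n N' ω')
    fun u hu => A.runAt_eq_of_localIso h hω (by omega) hu
  refine not_congr (exists_congr fun C => and_congr_right fun _ => ?_)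
  exact ⟨hiso.trans, hiso.symm.trans⟩

namespace Network

variable {V V' Inp : Type}

lemma card_neighborSet (N : Network V Inp) (u : V) :
    Nat.card (N.graph.neighborSet u) = N.deg u := by
  rw [Nat.card_congr (N.port u), Nat.card_fin]

/-! ### Balls in networks of bounded degree -/

lemma ncard_ball_le [Finite V] (N : Network V Inp) {Δ : ℕ} (hΔ : ∀ u, N.deg u ≤ Δ) (v : V) (s : ℕ) :
    {u | N.graph.edist v u ≤ s}.ncard ≤ (Δ + 1) ^ s := by
  classical
  have := Fintype.ofFinite V
  induction s with
  | zero => simp only [edist_le_zero_iff, pow_zero]; rw [Set.ofPred_eq_eq_singleton']; simp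
  | succ s ih =>
    let F : Finset V := Finset.univ.filter fun u => N.graph.edist v u ≤ s
    have hF : F.card = {u | N.graph.edist v u ≤ s}.ncard := by
      rw [← Set.ncard_coe_finset]; simp [F]
    have hsub : {u | N.graph.edist v u ≤ (s + 1 : ℕ)} ⊆
        (F.biUnion fun u => insert u (Finset.univ.filter fun x => N.graph.Adj u x) : Finset V) := by
      intro u hu
      rw [Finset.mem_coe, Finset.mem_biUnion]
      obtain rfl | ⟨x, hx, hadj⟩ := eq_or_exists_adj_of_edist_le_succ hu
      · exact ⟨v, by simp [F], by simp⟩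
      · exact ⟨x, by simpa [F] using hx, by simpa using Or.inr hadj⟩
    refine (Set.ncard_le_ncard hsub (Finset.finite_toSet _)).trans ?_
    rw [Set.ncard_coe_finset, pow_succ]
    refine (Finset.card_biUnion_le_card_mul F _ (Δ + 1) fun u _ => ?_).trans
      (Nat.mul_le_mul_right _ (hF.trans_le ih))
    refine (Finset.card_insert_le _ _).trans (Nat.succ_le_succ ?_)
    have : (Finset.univ.filter fun x => N.graph.Adj u x).card = N.deg u := by
      rw [← N.card_neighborSet, ← Set.ncard_coe_finset, ← Nat.card_coe_set_eq]
      congr! 2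
      ext x; simp
    exact this.trans_le (hΔ u)

/-- Every ball of a network can be found in a network with a prescribed larger number of vertices
and the same degree bound: cut it out and add isolated vertices. -/
theorem exists_localIso_fin [Finite V] (N : Network V Inp) {Δ : ℕ} (hΔ : ∀ u, N.deg u ≤ Δ) (v : V)
    {R m : ℕ} (hm : {u | N.graph.edist v u ≤ (R + 1 : ℕ)}.ncard ≤ m) :
    ∃ (H : Network (Fin m) Inp) (φ : V → Fin m), N.LocalIso H R v φ ∧ ∀ a, H.deg a ≤ Δ := by
  classical
  have := Fintype.ofFinite V
  set B : Set V := {u | N.graph.edist v u ≤ (R + 1 : ℕ)} with hB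
  have hBR : ∀ {u}, N.graph.edist v u ≤ R → u ∈ B := fun h => edist_le_mono h R.le_succ
  have hvB : v ∈ B := by simp [hB]
  obtain ⟨emb⟩ : Nonempty (B ↪ Fin m) := by
    apply Function.Embedding.nonempty_of_card_le
    rw [Fintype.card_fin, ← Nat.card_eq_fintype_card]
    exact hm
  let φ : V → Fin m := fun u => if h : u ∈ B then emb ⟨u, h⟩ else emb ⟨v, hvB⟩
  have hinj : ∀ {u x}, u ∈ B → x ∈ B → φ u = φ x → u = x := by
    intro u x hu hx h
    simp only [φ, dif_pos hu, dif_pos hx] at h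
    exact congrArg Subtype.val (emb.injective h)
  let Γ : SimpleGraph (Fin m) :=
    { Adj := fun a b => ∃ u x, u ∈ B ∧ x ∈ B ∧ N.graph.Adj u x ∧ φ u = a ∧ φ x = b
      symm := ⟨by
        rintro a b ⟨u, x, hu, hx, h, hua, hxb⟩
        exact ⟨x, u, hx, hu, h.symm, hxb, hua⟩⟩
      loopless := ⟨by
        rintro a ⟨u, x, hu, hx, h, rfl, hxu⟩
        exact h.ne (hinj hx hu hxu).symm⟩ }
  have hΓ : ∀ {u x}, u ∈ B → N.graph.Adj u x → x ∈ B → Γ.Adj (φ u) (φ x) :=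
    fun hu h hx => ⟨_, _, hu, hx, h, rfl, rfl⟩
  have hΓ' : ∀ {u b}, u ∈ B → Γ.Adj (φ u) b → ∃ x, N.graph.Adj u x ∧ φ x = b := by
    rintro u b hu ⟨u', x, hu', hx, h, huu, rfl⟩
    obtain rfl := hinj hu' hu huu
    exact ⟨x, h, rfl⟩
  have hcard : ∀ u, u ∈ B → Nat.card (Γ.neighborSet (φ u)) ≤ N.deg u := by
    intro u hu
    rw [← N.card_neighborSet]
    have hsub : Γ.neighborSet (φ u) ⊆ φ '' N.graph.neighborSet u := by
      intro b hb
      obtain ⟨x, hx, rfl⟩ := hΓ' hu hb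
      exact ⟨x, hx, rfl⟩
    rw [Nat.card_coe_set_eq, Nat.card_coe_set_eq]
    exact (Set.ncard_le_ncard hsub).trans (Set.ncard_image_le (Set.toFinite _))
  -- the vertices at distance at most `R` keep all their neighbors and hence their port numbers
  have hport : ∀ a, ∃ e : Γ.neighborSet a ≃ Fin (Nat.card (Γ.neighborSet a)),
      ∀ u, N.graph.edist v u ≤ R → φ u = a → Nat.card (Γ.neighborSet a) = N.deg u ∧
        ∀ x (h : N.graph.Adj u x) (h' : Γ.Adj a (φ x)), (e ⟨φ x, h'⟩ : ℕ) = N.port u ⟨x, h⟩ := by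
    intro a
    by_cases ha : ∃ u, N.graph.edist v u ≤ R ∧ φ u = a
    · obtain ⟨u, hu, rfl⟩ := ha
      let f : N.graph.neighborSet u → Γ.neighborSet (φ u) :=
        fun x => ⟨φ x, hΓ (hBR hu) x.2 (edist_le_of_adj hu x.2)⟩
      have hf : Function.Bijective f := by
        constructor
        · intro x y hxy
          exact Subtype.ext (hinj (edist_le_of_adj hu x.2) (edist_le_of_adj hu y.2)
            (congrArg Subtype.val hxy))
        · rintro ⟨b, hb⟩
          obtain ⟨x, hx, rfl⟩ := hΓ' (hBR hu) hb
          exact ⟨⟨x, hx⟩, rfl⟩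
      have hc : N.deg u = Nat.card (Γ.neighborSet (φ u)) := by
        rw [← N.card_neighborSet, Nat.card_congr (Equiv.ofBijective f hf)]
      refine ⟨(Equiv.ofBijective f hf).symm.trans ((N.port u).trans (finCongr hc)), ?_⟩
      intro u' hu' huu
      obtain rfl := hinj (hBR hu') (hBR hu) huu
      refine ⟨hc.symm, fun x h h' => ?_⟩
      have : (Equiv.ofBijective f hf).symm ⟨φ x, h'⟩ = ⟨x, h⟩ := by
        rw [Equiv.symm_apply_eq]; rfl
      simp only [Equiv.trans_apply, this, finCongr_apply, Fin.val_cast]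
    · exact ⟨Finite.equivFin _, fun u hu h => absurd ⟨u, hu, h⟩ ha⟩
  choose e he using hport
  let inp : Fin m → Inp := fun a =>
    if h : ∃ u, u ∈ B ∧ φ u = a then N.input h.choose else N.input v
  refine ⟨⟨Γ, fun a => Nat.card (Γ.neighborSet a), e, inp⟩, φ, ⟨?_, ?_, ?_, ?_⟩, ?_⟩
  · exact fun u hu => (he _ u hu rfl).1
  · intro u hu
    have h : ∃ u', u' ∈ B ∧ φ u' = φ u := ⟨u, hBR hu, rfl⟩
    simp only [inp, dif_pos h]
    rw [hinj h.choose_spec.1 (hBR hu) h.choose_spec.2]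
  · exact fun u x hu hx h => hinj (hBR hu) (hBR hx) h
  · intro u x h s hu hs
    have huR : N.graph.edist v u ≤ R := edist_le_mono hu (by omega)
    have hxR : N.graph.edist v x ≤ R := edist_le_mono (edist_le_of_adj hu h) hs
    have h' := hΓ (hBR huR) h (hBR hxR)
    exact ⟨h', (he _ u huR rfl).2 x h h', (he _ x hxR rfl).2 u h.symm h'.symm⟩
  · intro a
    by_cases ha : ∃ u, u ∈ B ∧ φ u = a
    · obtain ⟨u, hu, rfl⟩ := ha
      exact (hcard u hu).trans (hΔ u)
    · have : IsEmpty (Γ.neighborSet a) :=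
        ⟨fun ⟨b, u, x, hu, _, _, hua, _⟩ => ha ⟨u, hu, hua⟩⟩
      simp

lemma finite_of_deg_le [Finite Inp] (m Δ : ℕ) :
    Finite {H : Network (Fin m) Inp // ∀ a, H.deg a ≤ Δ} := by
  classical
  let code : {H : Network (Fin m) Inp // ∀ a, H.deg a ≤ Δ} →
      (Fin m → Fin m → Prop) × (Fin m → Fin (Δ + 1)) × (Fin m → Fin m → Fin (Δ + 1)) ×
        (Fin m → Inp) :=
    fun H => (H.1.graph.Adj, fun a => ⟨H.1.deg a, Nat.lt_succ_of_le (H.2 a)⟩,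
      fun a b => if h : H.1.graph.Adj a b then
        ⟨H.1.port a ⟨b, h⟩, (H.1.port a ⟨b, h⟩).2.trans (Nat.lt_succ_of_le (H.2 a))⟩ else 0,
      H.1.input)
  refine Finite.of_injective code ?_
  rintro ⟨⟨G, d, p, i⟩, h⟩ ⟨⟨G', d', p', i'⟩, h'⟩ heq
  simp only [code, Prod.mk.injEq] at heq
  obtain ⟨h1, h2, h3, rfl⟩ := heq
  obtain rfl : G = G' := SimpleGraph.ext h1
  obtain rfl : d = d' := funext fun a => congrArg Fin.val (congrFun h2 a)
  have : p = p' := by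
    funext a
    ext ⟨b, hb⟩
    have := congrFun (congrFun h3 a) b
    rw [dif_pos (show G.Adj a b from hb), dif_pos (show G.Adj a b from hb)] at this
    exact congrArg (fun c : Fin (Δ + 1) => (c : ℕ)) this
  subst this
  rfl

/-! ### Views -/

/-- The endpoint of the walk that starts at `v` and leaves every vertex through the given port. -/
def follow (N : Network V Inp) {Δ : ℕ} : V → List (Fin Δ) → Option V
  | v, [] => some v
  | v, i :: w => if h : i.1 < N.deg v then N.follow ((N.port v).symm ⟨i, h⟩).1 w else none

/-- What `v` sees within distance `R`: the labels at the endpoints of all walks of length at most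
`R`. Different walks may lead to the same vertex, and the view does not tell. -/
def view {L : Type} (N : Network V Inp) (Δ R : ℕ) (lab : V → L) (v : V) :
    List (Fin Δ) → Option L :=
  fun w => if w.length ≤ R then (N.follow v w).map lab else none

lemma follow_append (N : Network V Inp) {Δ : ℕ} (v : V) (w w' : List (Fin Δ)) :
    N.follow v (w ++ w') = (N.follow v w).bind fun u => N.follow u w' := by
  induction w generalizing v with
  | nil => rfl
  | cons i w ih =>
    simp only [List.cons_append, follow]
    split_ifs
    · exact ih _
    · rfl

lemma follow_port (N : Network V Inp) {Δ : ℕ} (hΔ : ∀ u, N.deg u ≤ Δ) {u x : V}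
    (h : N.graph.Adj u x) (w : List (Fin Δ)) :
    N.follow u (⟨N.port u ⟨x, h⟩, (N.port u ⟨x, h⟩).2.trans_le (hΔ u)⟩ :: w) = N.follow x w := by
  simp [follow]

lemma exists_follow_eq (N : Network V Inp) {Δ : ℕ} (hΔ : ∀ u, N.deg u ≤ Δ) {v u : V} {s : ℕ}
    (h : N.graph.edist v u ≤ s) : ∃ w : List (Fin Δ), w.length ≤ s ∧ N.follow v w = some u := by
  induction s generalizing u with
  | zero =>
    obtain rfl := edist_le_zero_iff.mp h
    exact ⟨[], le_rfl, rfl⟩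
  | succ s ih =>
    obtain rfl | ⟨x, hx, hadj⟩ := eq_or_exists_adj_of_edist_le_succ h
    · exact ⟨[], by simp, rfl⟩
    · obtain ⟨w, hw, hwx⟩ := ih hx
      refine ⟨w ++ [⟨N.port x ⟨u, hadj⟩, (N.port x ⟨u, hadj⟩).2.trans_le (hΔ x)⟩],
        by simpa using hw, ?_⟩
      · rw [follow_append, hwx]
        exact N.follow_port hΔ hadj []

/-- If the labels contain identifiers, then the view determines the ball. -/
theorem exists_localIso_of_view_eq {N : Network V Inp} {N' : Network V' Inp} {Δ : ℕ}
    (hΔ : ∀ u, N.deg u ≤ Δ) {J L : Type} {id : V → J} {id' : V' → J}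
    (hid : Function.Injective id) (hid' : Function.Injective id') {y : V → L} {y' : V' → L}
    {R : ℕ} {v : V} {v' : V'}
    (h : N.view Δ (R + 1) (fun u => (N.deg u, N.input u, id u, y u)) v =
      N'.view Δ (R + 1) (fun u => (N'.deg u, N'.input u, id' u, y' u)) v') :
    ∃ φ : V → V', φ v = v' ∧ N.LocalIso N' R v φ ∧
      ∀ u, N.graph.edist v u ≤ R → id' (φ u) = id u ∧ y' (φ u) = y u := by
  classical
  let φ : V → V' := fun u => if h : ∃ u', id' u' = id u then h.choose else v'
  have hφ : ∀ {u u'}, id' u' = id u → φ u = u' := by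
    intro u u' huu
    have h : ∃ u', id' u' = id u := ⟨u', huu⟩
    simp only [φ, dif_pos h]
    exact hid' (h.choose_spec.trans huu.symm)
  -- a walk from `v` to `u` leads from `v'` to `φ u`
  have hwalk : ∀ {w : List (Fin Δ)} {u : V}, w.length ≤ R + 1 → N.follow v w = some u →
      N'.follow v' w = some (φ u) ∧ N'.deg (φ u) = N.deg u ∧ N'.input (φ u) = N.input u ∧
        id' (φ u) = id u ∧ y' (φ u) = y u := by
    intro w u hw hwu
    have hv := congrFun h w
    simp only [view, if_pos hw, hwu, Option.map_some] at hv
    obtain ⟨u', hu', heq⟩ := Option.map_eq_some_iff.mp hv.symm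
    simp only [Prod.mk.injEq] at heq
    obtain rfl := hφ heq.2.2.1
    exact ⟨hu', heq⟩
  have hball : ∀ {u}, N.graph.edist v u ≤ R → N'.deg (φ u) = N.deg u ∧
      N'.input (φ u) = N.input u ∧ id' (φ u) = id u ∧ y' (φ u) = y u := by
    intro u hu
    obtain ⟨w, hw, hwu⟩ := N.exists_follow_eq hΔ hu
    exact (hwalk (by omega) hwu).2
  have hv : φ v = v' := by
    have := (hwalk (w := []) (u := v) (by simp) rfl).1
    exact (Option.some.inj this).symm
  refine ⟨φ, hv, ⟨fun u hu => (hball hu).1, fun u hu => (hball hu).2.1, ?_, ?_⟩,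
    fun u hu => (hball hu).2.2⟩
  · intro u x hu hx hux
    exact hid ((hball hu).2.2.1.symm.trans ((congrArg id' hux).trans (hball hx).2.2.1))
  · intro u x hadj s hu hs
    obtain ⟨w, hw, hwu⟩ := N.exists_follow_eq hΔ hu
    set i : Fin Δ := ⟨N.port u ⟨x, hadj⟩, (N.port u ⟨x, hadj⟩).2.trans_le (hΔ u)⟩ with hi
    set i' : Fin Δ := ⟨N.port x ⟨u, hadj.symm⟩,
      (N.port x ⟨u, hadj.symm⟩).2.trans_le (hΔ x)⟩ with hi'
    have hwx : N.follow v (w ++ [i]) = some x := by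
      rw [follow_append, hwu]; exact N.follow_port hΔ hadj []
    have hwu' : N.follow v (w ++ [i] ++ [i']) = some u := by
      rw [follow_append, hwx]; exact N.follow_port hΔ hadj.symm []
    have h1 := (hwalk (by omega) hwu).1
    have h2 := (hwalk (by simp; omega) hwx).1
    have h3 := (hwalk (by simp; omega) hwu').1
    have hstep : ∀ {a b : V'} {i : Fin Δ}, N'.follow a [i] = some b →
        ∃ h : N'.graph.Adj a b, (N'.port a ⟨b, h⟩ : ℕ) = i := by
      intro a b i hab
      simp only [follow] at hab
      split_ifs at hab with hlt
      · obtain rfl := Option.some.inj hab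
        refine ⟨((N'.port a).symm ⟨i, hlt⟩).2, ?_⟩
        simp
    rw [follow_append, h1, Option.bind_some] at h2
    obtain ⟨h', hp⟩ := hstep h2
    rw [follow_append, follow_append, h1, Option.bind_some, h2, Option.bind_some] at h3
    obtain ⟨h'', hp'⟩ := hstep h3
    exact ⟨h', hp, hp'⟩

end Network

lemma RandLocalAlgorithm.Solves.measurableSet_not_correct {Inp Out Msg : Type} [Finite Out] {Δ : ℕ}
    {P : LCL Inp Out} {A : RandLocalAlgorithm Inp Out Msg} (hA : A.Solves P Δ) {V : Type}
    [Fintype V] (N : Network V Inp) (hΔ : ∀ v, N.deg v ≤ Δ) :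
    MeasurableSet {ω | ¬ P.Correct N (A.run N ω)} := by
  have : {ω | ¬ P.Correct N (A.run N ω)} =
      ⋃ out ∈ {out | ¬ P.Correct N out}, ⋂ v, {ω | A.run N ω v = out v} := by
    ext ω
    simp only [Set.mem_ofPred_eq, Set.mem_iUnion, Set.mem_iInter, exists_prop]
    refine ⟨fun h => ⟨_, h, fun v => rfl⟩, fun ⟨out, h, heq⟩ => ?_⟩
    rwa [show A.run N ω = out from funext heq]
  rw [this]
  exact (Set.toFinite _).measurableSet_biUnion fun out _ =>
    MeasurableSet.iInter fun v => (hA V N hΔ).1 v (out v)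

/-- With a good palette, a local simulation of `A` that is told a constant number `m` of vertices
violates `P` at a given vertex with small probability, in networks of any size. -/
theorem exists_palette_violated_le {Inp Out Msg : Type} [Finite Inp] [Finite Out] {Δ : ℕ}
    {P : LCL Inp Out} {A : RandLocalAlgorithm Inp Out Msg} (hA : A.Solves P Δ) {m : ℕ} (hm : m ≠ 0)
    (hball : (Δ + 1) ^ (P.radius + A.rounds m + 2) ≤ m) :
    ∃ (k : ℕ) (e : (Fin k → Bool) → ℕ → Bool), ∀ (V : Type) [Fintype V] (N : Network V Inp),
      (∀ v, N.deg v ≤ Δ) → ∀ v, iidLaw V (iidLaw (Fin k) coin)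
        {y | P.Violated N (A.runAt m N fun u => e (y u)) v} ≤ 2 * (m : ENNReal)⁻¹ := by
  have := Network.finite_of_deg_le (Inp := Inp) m Δ
  obtain ⟨k, e, he⟩ := exists_palette (W := Fin m) (iidLaw ℕ coin)
    (F := fun H : {H : Network (Fin m) Inp // ∀ a, H.deg a ≤ Δ} =>
      {ω | ¬ P.Correct H.1 (A.run H.1 ω)}) (q := (m : ENNReal)⁻¹)
    (fun H => hA.measurableSet_not_correct H.1 H.2)
    (by simp) (by simpa using hm)
    (fun H => by
      rw [← randomBits_eq_iidLaw]
      simpa using (hA (Fin m) H.1 H.2).2)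
  refine ⟨k, e, fun V _ N hΔ v => ?_⟩
  obtain ⟨H, φ, hφ, hH⟩ := N.exists_localIso_fin hΔ v (R := P.radius + A.rounds m + 1) (m := m)
    ((N.ncard_ball_le hΔ v _).trans hball)
  let B : Set V := {u | N.graph.edist v u ≤ (P.radius + A.rounds m + 1 : ℕ)}
  -- the event only depends on the ball `B`, which has a copy in `H`
  let Q : Set (B → Fin k → Bool) :=
    {z | ∃ y : V → Fin k → Bool, (∀ u : B, y u = z u) ∧
      P.Violated N (A.runAt m N fun u => e (y u)) v}
  have hQm : NullMeasurableSet Q (iidLaw B (iidLaw (Fin k) coin)) :=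
    (Set.toFinite Q).measurableSet.nullMeasurableSet
  calc iidLaw V (iidLaw (Fin k) coin) {y | P.Violated N (A.runAt m N fun u => e (y u)) v}
      ≤ iidLaw V (iidLaw (Fin k) coin) ((fun y (u : B) => y u) ⁻¹' Q) :=
        measure_mono fun y hy => ⟨y, fun _ => rfl, hy⟩
    _ = iidLaw B (iidLaw (Fin k) coin) Q :=
        (measurePreserving_iidLaw_comp _ Subtype.val_injective).measure_preimage hQm
    _ = iidLaw (Fin m) (iidLaw (Fin k) coin) ((fun y (u : B) => y (φ u)) ⁻¹' Q) := by
        refine ((measurePreserving_iidLaw_comp _ (g := fun u : B => φ u)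
          fun u x hux => ?_).measure_preimage hQm).symm
        exact Subtype.ext (hφ.injOn u x u.2 x.2 hux)
    _ ≤ iidLaw (Fin m) (iidLaw (Fin k) coin)
          {y | (fun w => e (y w)) ∈ {ω | ¬ P.Correct H (A.run H ω)}} := by
        refine measure_mono ?_
        rintro y ⟨y', hyy, hbad⟩ hcorr
        rw [LCL.correct_iff, A.run_eq_runAt, Fintype.card_fin] at hcorr
        refine hcorr (φ v)
          ((P.violated_runAt_iff_of_localIso A hφ (fun u hu => ?_) le_rfl).mpr hbad)
        rw [hyy ⟨u, hu⟩]
    _ ≤ 2 * (m : ENNReal)⁻¹ := he ⟨H, hH⟩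

/-! ### Simulation by one-bit messages -/

namespace RandLocalAlgorithm

variable {V Inp Out Msg : Type}

/-- Simulation of `A` by one-bit messages: a round of `A` takes `L` rounds, in which the codes of
the messages are sent bit by bit. The state consists of the state of `A`, the number of bits already
sent in the current round of `A`, and the bits received so far through each port. -/
abbrev serialize (A : RandLocalAlgorithm Inp Out Msg) (L : ℕ) (code : Msg → ℕ → Bool)
    (decode : (ℕ → Bool) → Msg) : RandLocalAlgorithm Inp Out Bool where
  State := A.State × ℕ × (ℕ → ℕ → Bool)
  rounds n := L * A.rounds n
  init n d x ω := (A.init n d x ω, 0, fun _ _ => false)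
  send d s i := code (A.send d s.1 i) s.2.1
  receive d s m :=
    let buf : ℕ → ℕ → Bool := fun p q =>
      if q = s.2.1 then (if h : p < d then m ⟨p, h⟩ else false) else s.2.2 p q
    if s.2.1 + 1 = L then (A.receive d s.1 fun i => decode (buf i), 0, fun _ _ => false)
    else (s.1, s.2.1 + 1, buf)
  output s := A.output s.1

/-- The message that `A` sends to `v` through its port `i` in the states `s`. -/
def incoming (A : RandLocalAlgorithm Inp Out Msg) (N : Network V Inp) (s : V → A.State) (v : V)
    (i : Fin (N.deg v)) : Msg :=
  let u := (N.port v).symm i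
  A.send (N.deg u.1) (s u.1) (N.port u.1 ⟨v, N.graph.adj_symm u.2⟩)

lemma serialize_step_iterate (A : RandLocalAlgorithm Inp Out Msg) {L : ℕ} (hL : L ≠ 0)
    {code : Msg → ℕ → Bool} {decode : (ℕ → Bool) → Msg}
    (hcode : ∀ x, decode (fun q => if q < L then code x q else false) = x)
    (N : Network V Inp) (s : V → A.State) :
    ((A.serialize L code decode).step N)^[L] (fun v => (s v, 0, fun _ _ => false)) =
      fun v => (A.step N s v, 0, fun _ _ => false) := by
  have key : ∀ c < L,
      ((A.serialize L code decode).step N)^[c] (fun v => (s v, 0, fun _ _ => false)) =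
        fun v => (s v, c, fun p q => if q < c then
          (if h : p < N.deg v then code (A.incoming N s v ⟨p, h⟩) q else false) else false) := by
    intro c
    induction c with
    | zero => simp
    | succ c ih =>
      intro hc
      rw [Function.iterate_succ_apply', ih (by omega)]
      funext v
      simp only [step, serialize, if_neg (show ¬ (c + 1 = L) by omega), Prod.mk.injEq, true_and]
      funext p q
      by_cases hq : q = c
      · subst hq
        simp [incoming]
      · simp only [if_neg hq, show q < c + 1 ↔ q < c by omega]
  obtain ⟨c, rfl⟩ : ∃ c, L = c + 1 := ⟨L - 1, by omega⟩
  rw [Function.iterate_succ_apply', key c (by omega)]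
  funext v
  simp only [step, serialize, if_true, Prod.mk.injEq, and_true]
  congr 1
  funext i
  refine Eq.trans (congrArg decode ?_) (hcode (A.incoming N s v i))
  funext q
  by_cases hq : q = c
  · subst hq
    simp [incoming]
  · simp [if_neg hq, show q < c + 1 ↔ q < c by omega]

/-- Messages from a finite set can be replaced by one-bit messages at the cost of a constant factor
in the number of rounds. -/
theorem exists_bool_simulation [Finite Msg] [Nonempty Msg] (A : RandLocalAlgorithm Inp Out Msg) :
    ∃ (L : ℕ) (B : RandLocalAlgorithm Inp Out Bool), (∀ n, B.rounds n = L * A.rounds n) ∧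
      ∀ (V : Type) [Fintype V] (N : Network V Inp) (ω : V → ℕ → Bool),
        B.run N ω = A.run N ω := by
  have := Fintype.ofFinite Msg
  let c : Msg ≃ Fin (Fintype.card Msg) := Fintype.equivFin Msg
  let L := Fintype.card Msg
  -- the code of the `i`-th message has a single `true`, at position `i`
  let code : Msg → ℕ → Bool := fun x q => decide (q = c x)
  have hcode : ∀ x, (fun q => if q < L then code x q else false) = code x := by
    intro x
    funext q
    by_cases hq : q < L
    · rw [if_pos hq]
    · have : q ≠ c x := fun h => hq (h ▸ (c x).2)
      simp [code, this]
  have hinj : Function.Injective code := by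
    intro x x' h
    have := congrFun h (c x)
    simp only [code, decide_true] at this
    exact c.injective (Fin.ext (of_decide_eq_true this.symm))
  refine ⟨L, A.serialize L code (Function.invFun code), fun _ => rfl, fun V _ N ω => ?_⟩
  have hsemi : Function.Semiconj (fun (s : V → A.State) v => (s v, 0, fun _ _ => false))
      (A.step N) ((A.serialize L code (Function.invFun code)).step N)^[L] := fun s =>
    (A.serialize_step_iterate Fintype.card_ne_zero
      (fun x => by rw [hcode]; exact Function.leftInverse_invFun hinj x) N s).symm
  funext v
  have h := (hsemi.iterate_right (A.rounds (Fintype.card V))) fun u =>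
    A.init (Fintype.card V) (N.deg u) (N.input u) (ω u)
  rw [← Function.iterate_mul] at h
  exact congrArg (fun s => A.output (s v).1) h.symm

end RandLocalAlgorithm

/-! ### Publishing symbols within a constant radius -/

/-- An algorithm in a model where, in each round, every vertex publishes a symbol, and then learns
its view of the published symbols within a constant radius. -/
structure PublishingAlgorithm (Inp Out Sym : Type) (Δ : ℕ) where
  State : Type
  rounds : ℕ → ℕ
  init : (n d : ℕ) → Inp → (ℕ → Bool) → State
  publish : State → Sym
  update : State → (List (Fin Δ) → Option Sym) → State
  output : State → Out

namespace PublishingAlgorithm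

variable {V Inp Out Sym : Type} {Δ : ℕ}

/-- One round on the network `N`, with views of radius `R`. -/
def step (Q : PublishingAlgorithm Inp Out Sym Δ) (R : ℕ) (N : Network V Inp) (s : V → Q.State) :
    V → Q.State :=
  fun v => Q.update (s v) (N.view Δ R (fun u => Q.publish (s u)) v)

/-- The output labeling computed with views of radius `R`. -/
def run [Fintype V] (Q : PublishingAlgorithm Inp Out Sym Δ) (R : ℕ) (N : Network V Inp)
    (ω : V → ℕ → Bool) : V → Out := fun v =>
  Q.output ((Q.step R N)^[Q.rounds (Fintype.card V)]
    (fun u => Q.init (Fintype.card V) (N.deg u) (N.input u) (ω u)) v)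

/-- The view of radius `0`. -/
def baseView (Δ : ℕ) (a : Sym) : List (Fin Δ) → Option Sym
  | [] => some a
  | _ :: _ => none

/-- Simulation of `Q` by message passing: a view of radius `R` is built up in `R` rounds, in which
the views of smaller radius are sent to all neighbors. -/
abbrev relay (Q : PublishingAlgorithm Inp Out Sym Δ) (R : ℕ) :
    RandLocalAlgorithm Inp Out ({w : List (Fin Δ) // w.length ≤ R} → Option Sym) where
  State := Q.State × ℕ × (List (Fin Δ) → Option Sym)
  rounds n := R * Q.rounds n
  init n d x ω := (Q.init n d x ω, 0, baseView Δ (Q.publish (Q.init n d x ω)))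
  send _ s _ := fun w => s.2.2 w
  receive d s m :=
    let view : List (Fin Δ) → Option Sym := fun w =>
      match w with
      | [] => some (Q.publish s.1)
      | i :: w => if h : i.1 < d ∧ w.length ≤ R then m ⟨i.1, h.1⟩ ⟨w, h.2⟩ else none
    if s.2.1 + 1 = R then
      (Q.update s.1 view, 0, baseView Δ (Q.publish (Q.update s.1 view)))
    else (s.1, s.2.1 + 1, view)
  output s := Q.output s.1

lemma baseView_eq_view (N : Network V Inp) (lab : V → Sym) (v : V) :
    baseView Δ (lab v) = N.view Δ 0 lab v := by
  funext w
  cases w with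
  | nil => simp [baseView, Network.view, Network.follow]
  | cons i w => simp [baseView, Network.view]

lemma view_cons (N : Network V Inp) (lab : V → Sym) (v : V) (c : ℕ) (i : Fin Δ)
    (w : List (Fin Δ)) : N.view Δ (c + 1) lab v (i :: w) =
      if h : i.1 < N.deg v then N.view Δ c lab ((N.port v).symm ⟨i, h⟩).1 w else none := by
  by_cases h : i.1 < N.deg v <;> simp [Network.view, Network.follow, h]

lemma relay_step_iterate (Q : PublishingAlgorithm Inp Out Sym Δ) {R : ℕ} (hR : R ≠ 0)
    (N : Network V Inp) (s : V → Q.State) :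
    ((Q.relay R).step N)^[R] (fun v => (s v, 0, baseView Δ (Q.publish (s v)))) =
      fun v => (Q.step R N s v, 0, baseView Δ (Q.publish (Q.step R N s v))) := by
  have hview : ∀ c < R, ∀ v, (fun w : List (Fin Δ) => match w with
      | [] => some (Q.publish (s v))
      | i :: w => if h : i.1 < N.deg v ∧ w.length ≤ R then
          N.view Δ c (fun u => Q.publish (s u)) ((N.port v).symm ⟨i, h.1⟩).1 w else none) =
      N.view Δ (c + 1) (fun u => Q.publish (s u)) v := by
    intro c hc v
    funext w
    cases w with
    | nil => simp [Network.view, Network.follow]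
    | cons i w =>
      rw [view_cons]
      by_cases h : i.1 < N.deg v
      · by_cases hw : w.length ≤ R
        · simp [h, hw]
        · have : ¬ w.length ≤ c := by omega
          simp [h, hw, Network.view, this]
      · simp [h]
  have key : ∀ c < R,
      ((Q.relay R).step N)^[c] (fun v => (s v, 0, baseView Δ (Q.publish (s v)))) =
        fun v => (s v, c, N.view Δ c (fun u => Q.publish (s u)) v) := by
    intro c
    induction c with
    | zero =>
      intro _
      funext v
      simp only [Function.iterate_zero, id_eq]
      rw [baseView_eq_view N fun u => Q.publish (s u)]
    | succ c ih =>
      intro hc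
      rw [Function.iterate_succ_apply', ih (by omega)]
      funext v
      rw [← hview c (by omega) v]
      simp only [RandLocalAlgorithm.step, relay, if_neg (show ¬ (c + 1 = R) by omega)]
  obtain ⟨c, rfl⟩ : ∃ c, R = c + 1 := ⟨R - 1, by omega⟩
  rw [Function.iterate_succ_apply', key c (by omega)]
  funext v
  simp only [step, ← hview c (by omega) v]
  simp only [RandLocalAlgorithm.step, if_true]

/-- Publishing symbols from a finite set can be simulated with one-bit messages at the cost of a
constant factor in the number of rounds. -/
theorem exists_bool_simulation [Finite Sym] (Q : PublishingAlgorithm Inp Out Sym Δ) {R : ℕ}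
    (hR : R ≠ 0) :
    ∃ (L : ℕ) (B : RandLocalAlgorithm Inp Out Bool), (∀ n, B.rounds n = L * Q.rounds n) ∧
      ∀ (V : Type) [Fintype V] (N : Network V Inp) (ω : V → ℕ → Bool),
        B.run N ω = Q.run R N ω := by
  have : Finite {w : List (Fin Δ) // w.length ≤ R} := List.finite_length_le (Fin Δ) R
  obtain ⟨L, B, hB, hrun⟩ := (Q.relay R).exists_bool_simulation
  refine ⟨L * R, B, fun n => by rw [hB, mul_assoc], fun V _ N ω => ?_⟩
  rw [hrun]
  have hsemi : Function.Semiconj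
      (fun (s : V → Q.State) v => (s v, 0, baseView Δ (Q.publish (s v))))
      (Q.step R N) ((Q.relay R).step N)^[R] := fun s => (Q.relay_step_iterate hR N s).symm
  funext v
  have h := (hsemi.iterate_right (Q.rounds (Fintype.card V))) fun u =>
    Q.init (Fintype.card V) (N.deg u) (N.input u) (ω u)
  rw [← Function.iterate_mul] at h
  exact congrArg (fun s => Q.output (s v).1) h.symm

end PublishingAlgorithm

/-! ### The number of values used by the resampling process -/

namespace EventSystem

variable {V Y J : Type} [LinearOrder J] {S : EventSystem V Y} {id : V → J} {X X' : V → ℕ → Y}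

lemma counter_le (i : ℕ) (x : V) : S.counter id X i x ≤ i := by
  induction i with
  | zero => simp [counter]
  | succ i ih =>
    simp only [counter]
    split_ifs <;> omega

lemma counter_congr {i : ℕ} (h : ∀ x, ∀ c < i, X x c = X' x c) :
    S.counter id X i = S.counter id X' i := by
  induction i with
  | zero => rfl
  | succ i ih =>
    have hi := ih fun x c hc => h x c (by omega)
    have hcur : (fun z => X z (S.counter id X i z)) = fun z => X' z (S.counter id X' i z) := by
      funext z
      rw [hi]
      exact h z _ (Nat.lt_succ_of_le (counter_le i z))
    funext x
    rw [counter, counter, hcur, hi]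

lemma current_congr {i : ℕ} (h : ∀ x, ∀ c ≤ i, X x c = X' x c) :
    S.current id X i = S.current id X' i := by
  funext x
  rw [current, current, counter_congr fun x c hc => h x c hc.le]
  exact h x _ (counter_le i x)

end EventSystem

/-! ### Distributed resampling -/

/-- The data of a local simulation: run `A` as if there were `m` vertices, with random strings taken
from the palette `e`. The variables of the resulting event system are the colors, indices into the
palette, and the event of a vertex says that the output violates `P` there. -/
structure Simulation (Inp Out Msg : Type) where
  P : LCL Inp Out
  A : RandLocalAlgorithm Inp Out Msg
  m : ℕ
  k : ℕ
  palette : (Fin k → Bool) → ℕ → Bool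

namespace Simulation

variable {Inp Out Msg V V' : Type} (T : Simulation Inp Out Msg)

/-- The radius on which the event of a vertex depends. -/
def radius : ℕ := T.P.radius + T.A.rounds T.m + 1

/-- The output labeling determined by the colors `y`. -/
def out (N : Network V Inp) (y : V → Fin T.k → Bool) : V → Out :=
  T.A.runAt T.m N fun u => T.palette (y u)

lemma violated_iff_of_localIso {N : Network V Inp} {N' : Network V' Inp} {R : ℕ} {v : V}
    {φ : V → V'} (h : N.LocalIso N' R v φ) (hR : T.radius ≤ R) {y : V → Fin T.k → Bool}
    {y' : V' → Fin T.k → Bool} (hy : ∀ u, N.graph.edist v u ≤ R → y' (φ u) = y u) :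
    T.P.Violated N' (T.out N' y') (φ v) ↔ T.P.Violated N (T.out N y) v :=
  T.P.violated_runAt_iff_of_localIso T.A h (fun u hu => by rw [hy u hu]) hR

/-- The violations of `P`, as a system of bad events. -/
def system (N : Network V Inp) : EventSystem V (Fin T.k → Bool) where
  vbl v := {u | N.graph.edist v u ≤ T.radius}
  near u v := N.graph.edist u v ≤ (2 * T.radius : ℕ)
  bad y v := T.P.Violated N (T.out N y) v
  near_refl v := by simp
  near_symm h := by rwa [SimpleGraph.edist_comm]
  near_of_mem {u v x} hu hv := by
    rw [Set.mem_ofPred_eq] at hu hv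
    rw [SimpleGraph.edist_comm] at hv
    rw [two_mul]
    exact edist_le_add hu hv
  bad_congr {y y' v} h hbad :=
    (T.violated_iff_of_localIso (Network.LocalIso.id N T.radius v) le_rfl
      fun u hu => (h u hu).symm).mpr hbad

lemma ncard_rel_le [Finite V] {N : Network V Inp} {Δ : ℕ} (hΔ : ∀ u, N.deg u ≤ Δ) (v : V) :
    {u | (T.system N).rel v u}.ncard ≤ (Δ + 1) ^ (4 * T.radius) := by
  refine (Set.ncard_le_ncard ?_ (Set.toFinite _)).trans (N.ncard_ball_le hΔ v (4 * T.radius))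
  rintro u ⟨w, hvw, hwu⟩
  exact edist_le_mono (edist_le_add hvw hwu) (by omega)

section Transfer

variable {J : Type} [LinearOrder J] {N : Network V Inp} {N' : Network V' Inp} {v : V} {φ : V → V'}
  {y : V → Fin T.k → Bool} {y' : V' → Fin T.k → Bool} {id : V → J} {id' : V' → J}

lemma selected_iff_of_localIso (h : N.LocalIso N' (3 * T.radius) v φ)
    (hy : ∀ u, N.graph.edist v u ≤ (3 * T.radius : ℕ) → id' (φ u) = id u ∧ y' (φ u) = y u) :
    (T.system N').selected id' y' (φ v) ↔ (T.system N).selected id y v := by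
  have hbad : ∀ u, N.graph.edist v u ≤ (2 * T.radius : ℕ) →
      ((T.system N').bad y' (φ u) ↔ (T.system N).bad y u) := fun u hu =>
    T.violated_iff_of_localIso (h.recenter (R' := T.radius) hu (by omega)) le_rfl fun x hx =>
      (hy x (edist_le_mono (edist_le_add hu hx) (by omega))).2
  have hid : ∀ u, N.graph.edist v u ≤ (2 * T.radius : ℕ) → id' (φ u) = id u := fun u hu =>
    (hy u (edist_le_mono hu (by omega))).1
  have hv : N.graph.edist v v ≤ (2 * T.radius : ℕ) := by simp
  refine and_congr (hbad v hv) ⟨fun h' u hu hub => ?_, fun h' a ha hab => ?_⟩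
  · have := h' (φ u) (h.edist_le (by omega) hu) ((hbad u hu).mpr hub)
    rwa [hid v hv, hid u hu] at this
  · obtain ⟨u, hu, rfl⟩ := h.exists_of_edist_le (by omega) ha
    rw [hid v hv, hid u hu]
    exact h' u hu ((hbad u hu).mp hab)

lemma resampled_iff_of_localIso (h : N.LocalIso N' (4 * T.radius) v φ)
    (hy : ∀ u, N.graph.edist v u ≤ (4 * T.radius : ℕ) → id' (φ u) = id u ∧ y' (φ u) = y u) :
    (T.system N').resampled id' y' (φ v) ↔ (T.system N).resampled id y v := by
  have hsel : ∀ u, N.graph.edist v u ≤ T.radius →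
      ((T.system N').selected id' y' (φ u) ↔ (T.system N).selected id y u) := fun u hu =>
    T.selected_iff_of_localIso (h.recenter hu (by omega)) fun x hx =>
      hy x (edist_le_mono (edist_le_add hu hx) (by omega))
  constructor
  · rintro ⟨a, ha, hav⟩
    have hav' : N'.graph.edist (φ v) a ≤ T.radius := by
      rw [SimpleGraph.edist_comm]; exact hav
    obtain ⟨u, hu, rfl⟩ := h.exists_of_edist_le (by omega) hav'
    refine ⟨u, (hsel u hu).mp ha, ?_⟩
    rw [SimpleGraph.edist_comm] at hu
    exact hu
  · rintro ⟨u, hu, huv⟩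
    have huv' : N.graph.edist v u ≤ T.radius := by
      rw [SimpleGraph.edist_comm]; exact huv
    refine ⟨φ u, (hsel u huv').mpr hu, ?_⟩
    have := h.edist_le (by omega) huv'
    rw [SimpleGraph.edist_comm] at this
    exact this

end Transfer

/-! ### Local decisions -/

/-- Identifiers: infinite bit strings in lexicographic order. -/
abbrev Ident : Type := Lex (ℕ → Bool)

/-- What a vertex has to know about another one: its degree, input label, identifier and color. -/
abbrev Label (Inp : Type) (k : ℕ) : Type := ℕ × Inp × Ident × (Fin k → Bool)

/-- The labels on the network `N` with identifiers `id` and colors `y`. -/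
def label (N : Network V Inp) {k : ℕ} (id : V → Ident) (y : V → Fin k → Bool) (u : V) :
    Label Inp k :=
  (N.deg u, N.input u, id u, y u)

variable (Δ : ℕ)

/-- The radius of the views on which local decisions are based. -/
def viewRadius : ℕ := 4 * T.radius + 1

/-- The view `κ` is that of a vertex, on a network with unique identifiers, where the property `p`
holds. -/
def Sees (κ : List (Fin Δ) → Option (Label Inp T.k))
    (p : ∀ {V : Type}, Network V Inp → (V → Ident) → (V → Fin T.k → Bool) → V → Prop) : Prop :=
  ∃ (V : Type) (N : Network V Inp) (id : V → Ident) (y : V → Fin T.k → Bool) (v : V),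
    Function.Injective id ∧ κ = N.view Δ T.viewRadius (label N id y) v ∧ p N id y v

variable {Δ}

/-- Local decisions are sound: a property that is invariant under `LocalIso` can be read off from
the view. -/
lemma sees_iff {N : Network V Inp} (hΔ : ∀ u, N.deg u ≤ Δ) {id : V → Ident}
    (hid : Function.Injective id) {y : V → Fin T.k → Bool} {v : V}
    {p : ∀ {V : Type}, Network V Inp → (V → Ident) → (V → Fin T.k → Bool) → V → Prop}
    (hp : ∀ {V' : Type} {N' : Network V' Inp} {id' : V' → Ident} {y' : V' → Fin T.k → Bool}
      {φ : V → V'}, N.LocalIso N' (4 * T.radius) v φ →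
      (∀ u, N.graph.edist v u ≤ (4 * T.radius : ℕ) → id' (φ u) = id u ∧ y' (φ u) = y u) →
      p N' id' y' (φ v) → p N id y v) :
    T.Sees Δ (N.view Δ T.viewRadius (label N id y) v) p ↔ p N id y v := by
  constructor
  · rintro ⟨V', N', id', y', v', hid', hview, h⟩
    obtain ⟨φ, rfl, hφ, hy⟩ := Network.exists_localIso_of_view_eq hΔ hid hid' hview
    exact hp hφ hy h
  · exact fun h => ⟨V, N, id, y, v, hid, rfl, h⟩

/-- Decision of a vertex with view `κ` whether it is resampled. -/
def SeesResampled (κ : List (Fin Δ) → Option (Label Inp T.k)) : Prop :=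
  T.Sees Δ κ fun N id y v => (T.system N).resampled id y v

lemma seesResampled_iff {N : Network V Inp} (hΔ : ∀ u, N.deg u ≤ Δ) {id : V → Ident}
    (hid : Function.Injective id) (y : V → Fin T.k → Bool) (v : V) :
    T.SeesResampled (N.view Δ T.viewRadius (label N id y) v) ↔ (T.system N).resampled id y v :=
  T.sees_iff hΔ hid fun hφ hy h => (T.resampled_iff_of_localIso hφ hy).mp h

open Classical in
/-- The output label of a vertex with view `κ`, or `default` if the view is inconsistent. -/
noncomputable def seenOut (κ : List (Fin Δ) → Option (Label Inp T.k)) (default : Out) : Out :=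
  if h : ∃ x, T.Sees Δ κ fun N _ y v => T.out N y v = x then h.choose else default

lemma seenOut_eq {N : Network V Inp} (hΔ : ∀ u, N.deg u ≤ Δ) {id : V → Ident}
    (hid : Function.Injective id) (y : V → Fin T.k → Bool) (v : V) (default : Out) :
    T.seenOut (N.view Δ T.viewRadius (label N id y) v) default = T.out N y v := by
  have hsees : ∀ x, (T.Sees Δ (N.view Δ T.viewRadius (label N id y) v)
      fun N _ y v => T.out N y v = x) ↔ T.out N y v = x := fun x =>
    T.sees_iff hΔ hid fun {_ N' _ y' φ} hφ hy h => by
      refine Eq.trans (Eq.symm ?_) h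
      refine T.A.runAt_eq_of_localIso hφ (fun u hu => ?_) (s := 0) ?_ (by simp)
      · rw [(hy u hu).2]
      · rw [radius]; omega
  have h : ∃ x, T.Sees Δ (N.view Δ T.viewRadius (label N id y) v)
      fun N _ y v => T.out N y v = x := ⟨_, (hsees _).mpr rfl⟩
  rw [seenOut, dif_pos h]
  exact ((hsees _).mp h.choose_spec).symm

end Simulation

/-! ### The solver -/

namespace Simulation

variable {Inp Out Msg V : Type} (T : Simulation Inp Out Msg) {Δ : ℕ}

/-- The length of the random identifiers in a network with `n` vertices. -/
def idLength (n : ℕ) : ℕ := 3 * Nat.clog 2 n + 1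

/-- The number of iterations of parallel resampling in a network with `n` vertices. -/
def iterations (n : ℕ) : ℕ := 2 * Nat.clog 2 n + 1

/-- The identifier of a vertex: its first `b` random bits, padded with zeros. -/
def ident (b : ℕ) (ω : ℕ → Bool) : Ident := toLex fun i => if i < b then ω i else false

/-- The successive colors of a vertex: the blocks of `k` random bits that follow the identifier. -/
def color (k b : ℕ) (ω : ℕ → Bool) (c : ℕ) : Fin k → Bool := fun i => ω (b + c * k + i)

/-- The symbols that are published: degree, input label, one bit of the identifier, and color. -/
abbrev Sym (Inp : Type) (Δ k : ℕ) : Type := Fin (Δ + 1) × Inp × Bool × (Fin k → Bool)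

/-- The labels within the view at time `j`, when the views at the times `i` are `hist i` and the
bits of the identifiers have been published one by one at the times less than `b`. -/
def known {Δ k : ℕ} (b : ℕ) (hist : ℕ → List (Fin Δ) → Option (Sym Inp Δ k)) (j : ℕ) :
    List (Fin Δ) → Option (Label Inp k) := fun w =>
  (hist j w).map fun s => (s.1, s.2.1,
    toLex fun i => if i < b then ((hist i w).map fun s' => s'.2.2.1).getD false else false, s.2.2.2)

/-- The memory of a vertex: the initial information, the time, the number of times that its color
has been resampled, and the views it has received so far. -/
structure Memory (Inp : Type) (Δ k : ℕ) where
  size : ℕ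
  deg : ℕ
  input : Inp
  bits : ℕ → Bool
  time : ℕ
  count : ℕ
  hist : ℕ → List (Fin Δ) → Option (Sym Inp Δ k)

open Classical in
/-- The symbols published in every round contain the current color and one more bit of the
identifier. Once the identifiers are known, every round is an iteration of parallel resampling,
except for the last one, which reveals the final colors. -/
noncomputable def solver (Δ : ℕ) : PublishingAlgorithm Inp Out (Sym Inp Δ T.k) Δ where
  State := Memory Inp Δ T.k
  rounds n := idLength n + iterations n + 1
  init n d x ω := ⟨n, d, x, ω, 0, 0, fun _ _ => none⟩
  publish s := (Fin.ofNat (Δ + 1) s.deg, s.input, s.bits s.time,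
    color T.k (idLength s.size) s.bits s.count)
  update s view :=
    let hist := Function.update s.hist s.time view
    { s with
      time := s.time + 1
      hist := hist
      count := s.count + if idLength s.size ≤ s.time ∧
        T.SeesResampled (known (idLength s.size) hist s.time) then 1 else 0 }
  output s := T.seenOut (known (idLength s.size) s.hist (s.time - 1))
    (T.A.output (T.A.init 0 s.deg s.input s.bits))

section Run

variable (N : Network V Inp) (n : ℕ) (ω : V → ℕ → Bool)

/-- The number of times that a color has been resampled at time `j`. -/
noncomputable def countAt (j : ℕ) : V → ℕ :=
  (T.system N).counter (fun u => ident (idLength n) (ω u))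
    (fun u => color T.k (idLength n) (ω u)) (j - idLength n)

/-- The colors at time `j`. -/
noncomputable def colorAt (j : ℕ) (u : V) : Fin T.k → Bool :=
  color T.k (idLength n) (ω u) (T.countAt N n ω j u)

lemma colorAt_eq (j : ℕ) : T.colorAt N n ω j =
    (T.system N).current (fun u => ident (idLength n) (ω u))
      (fun u => color T.k (idLength n) (ω u)) (j - idLength n) := rfl

/-- The symbols published at time `j`. -/
noncomputable def symAt (Δ : ℕ) (j : ℕ) (u : V) : Sym Inp Δ T.k :=
  (Fin.ofNat (Δ + 1) (N.deg u), N.input u, ω u j, T.colorAt N n ω j u)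

/-- The views received up to time `j`. -/
noncomputable def histAt (Δ : ℕ) (j : ℕ) (v : V) (i : ℕ) : List (Fin Δ) → Option (Sym Inp Δ T.k) :=
  if i < j then N.view Δ T.viewRadius (T.symAt N n ω Δ i) v else fun _ => none

variable {N}

lemma known_histAt (hΔ : ∀ u, N.deg u ≤ Δ) {i j : ℕ} (hi : i < j) (hb : idLength n ≤ i) (v : V) :
    known (idLength n) (T.histAt N n ω Δ j v) i =
      N.view Δ T.viewRadius
        (label N (fun u => ident (idLength n) (ω u)) (T.colorAt N n ω i)) v := by
  funext w
  simp only [known, histAt, if_pos hi, Network.view]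
  by_cases hw : w.length ≤ T.viewRadius
  · simp only [if_pos hw, Option.map_map]
    cases hf : N.follow v w with
    | none => rfl
    | some u =>
      simp only [Option.map_some, Option.some.injEq, Function.comp, symAt, label, Prod.mk.injEq,
        true_and, and_true]
      refine ⟨?_, ?_⟩
      · rw [Fin.val_ofNat]
        exact Nat.mod_eq_of_lt (Nat.lt_succ_of_le (hΔ u))
      · unfold ident
        congr 1
        funext l
        by_cases hl : l < idLength n
        · simp [if_pos hl, show l < j by omega, hf, hw, Network.view, symAt]
        · simp [if_neg hl]
  · simp [if_neg hw]

/-- With unique identifiers, the distributed solver carries out the resampling process. -/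
lemma solver_step_iterate (hΔ : ∀ u, N.deg u ≤ Δ)
    (hid : Function.Injective fun u => ident (idLength n) (ω u)) (j : ℕ) :
    ((T.solver Δ).step T.viewRadius N)^[j]
      (fun u => (T.solver Δ).init n (N.deg u) (N.input u) (ω u)) =
      fun v => (⟨n, N.deg v, N.input v, ω v, j, T.countAt N n ω j v, T.histAt N n ω Δ j v⟩ :
        Memory Inp Δ T.k) := by
  induction j with
  | zero =>
    funext v
    simp only [Function.iterate_zero, id, solver, Memory.mk.injEq, true_and]
    refine ⟨?_, ?_⟩
    · simp [countAt, EventSystem.counter]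
    · funext i
      simp [histAt]
  | succ j ih =>
    rw [Function.iterate_succ_apply', ih]
    funext v
    have hupd : Function.update (T.histAt N n ω Δ j v) j
        (N.view Δ T.viewRadius (T.symAt N n ω Δ j) v) = T.histAt N n ω Δ (j + 1) v := by
      funext i
      by_cases hi : i = j
      · subst hi
        simp [histAt]
      · rw [Function.update_of_ne hi]
        simp only [histAt, show i < j + 1 ↔ i < j by omega]
    have hpub : (fun u => (T.solver Δ).publish (⟨n, N.deg u, N.input u, ω u, j,
        T.countAt N n ω j u, T.histAt N n ω Δ j u⟩ : Memory Inp Δ T.k)) =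
        T.symAt N n ω Δ j := rfl
    simp only [PublishingAlgorithm.step]
    rw [hpub]
    simp only [solver, hupd, Memory.mk.injEq, true_and, and_true]
    by_cases hj : idLength n ≤ j
    · have hres := T.seesResampled_iff hΔ hid (T.colorAt N n ω j) v
      rw [← T.known_histAt n ω hΔ (Nat.lt_succ_self j) hj v, ← hupd,
        colorAt_eq] at hres
      simp only [countAt, show j + 1 - idLength n = j - idLength n + 1 by omega]
      by_cases h : T.SeesResampled (known (idLength n) (Function.update (T.histAt N n ω Δ j v) j
          (N.view Δ T.viewRadius (T.symAt N n ω Δ j) v)) j)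
      · rw [if_pos ⟨hj, h⟩, EventSystem.counter_succ_of_resampled (hres.mp h)]
      · rw [if_neg fun h' => h h'.2,
          EventSystem.counter_succ_of_not_resampled fun h' => h (hres.mpr h'), add_zero]
    · rw [if_neg fun h => hj h.1]
      simp only [countAt, show j + 1 - idLength n = 0 by omega, show j - idLength n = 0 by omega,
        add_zero]

lemma solver_run_eq [Fintype V] (hΔ : ∀ u, N.deg u ≤ Δ)
    (hid : Function.Injective fun u => ident (idLength (Fintype.card V)) (ω u)) :
    (T.solver Δ).run T.viewRadius N ω =
      T.out N ((T.system N).current (fun u => ident (idLength (Fintype.card V)) (ω u))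
        (fun u => color T.k (idLength (Fintype.card V)) (ω u)) (iterations (Fintype.card V))) := by
  funext v
  set n := Fintype.card V with hn
  have hrun : (T.solver Δ).run T.viewRadius N ω v = (T.solver Δ).output
      ((((T.solver Δ).step T.viewRadius N)^[(T.solver Δ).rounds n]
        (fun u => (T.solver Δ).init n (N.deg u) (N.input u) (ω u))) v) := rfl
  rw [hrun, T.solver_step_iterate n ω hΔ hid]
  simp only [solver]
  rw [show idLength n + iterations n + 1 - 1 = idLength n + iterations n by omega,
    T.known_histAt n ω hΔ (Nat.lt_succ_self _) (Nat.le_add_right _ _) v,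
    T.seenOut_eq hΔ hid, colorAt_eq, Nat.add_sub_cancel_left]

end Run

end Simulation

/-! ### Using finitely many random bits -/

/-- The first `M` bits of `ω`, padded with zeros. -/
def truncateBits (M : ℕ) (ω : ℕ → Bool) : ℕ → Bool := fun i => if i < M then ω i else false

/-- The algorithm `B`, restricted to the first `M n` random bits of every vertex. -/
def RandLocalAlgorithm.truncate {Inp Out Msg : Type} (B : RandLocalAlgorithm Inp Out Msg)
    (M : ℕ → ℕ) : RandLocalAlgorithm Inp Out Msg :=
  { B with init := fun n d x ω => B.init n d x (truncateBits (M n) ω) }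

lemma RandLocalAlgorithm.truncate_run {V Inp Out Msg : Type} [Fintype V]
    (B : RandLocalAlgorithm Inp Out Msg) (M : ℕ → ℕ) (N : Network V Inp) (ω : V → ℕ → Bool) :
    (B.truncate M).run N ω = B.run N fun u => truncateBits (M (Fintype.card V)) (ω u) := rfl

lemma RandLocalAlgorithm.measurableSet_truncate_run_eq {V Inp Out Msg : Type} [Fintype V]
    (B : RandLocalAlgorithm Inp Out Msg) (M : ℕ → ℕ) (N : Network V Inp) (v : V) (x : Out) :
    MeasurableSet {ω | (B.truncate M).run N ω v = x} := by
  set m := M (Fintype.card V) with hm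
  let f : (V → ℕ → Bool) → V → Fin m → Bool := fun ω u i => ω u i
  have hf : Measurable f := by fun_prop
  let g : (V → Fin m → Bool) → V → ℕ → Bool := fun z u i => if h : i < m then z u ⟨i, h⟩ else false
  have hg : ∀ ω, (fun u => truncateBits m (ω u)) = g (f ω) := by
    intro ω
    funext u i
    by_cases h : i < m <;> simp [truncateBits, g, f, h]
  have : {ω | (B.truncate M).run N ω v = x} = f ⁻¹' {z | B.run N (g z) v = x} := by
    ext ω
    rw [Set.mem_ofPred_eq, B.truncate_run, ← hm, hg]
    rfl
  rw [this]
  exact hf (Set.toFinite _).measurableSet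

/-! ### The failure probability -/

namespace Simulation

lemma randomBits_ident_not_injective_le (V : Type) [Fintype V] (b : ℕ) :
    randomBits V {ω | ¬ Function.Injective fun u => ident b (ω u)} ≤
      (Fintype.card V : ENNReal) ^ 2 * 2⁻¹ ^ b := by
  have hmp : MeasurePreserving (fun (ω : V → ℕ → Bool) u (i : Fin b) => ω u i)
      (randomBits V) (iidLaw V (iidLaw (Fin b) coin)) := by
    rw [randomBits_eq_iidLaw]
    exact (measurePreserving_iidLaw_curry (ι := V) (κ := Fin b) coin).comp
      ((measurePreserving_iidLaw_comp coin (g := fun q : V × Fin b => (q.1, (q.2 : ℕ)))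
        fun q q' h => by
          simp only [Prod.mk.injEq] at h
          exact Prod.ext h.1 (Fin.ext h.2)).comp (measurePreserving_iidLaw_uncurry coin))
  have hsub : {ω : V → ℕ → Bool | ¬ Function.Injective fun u => ident b (ω u)} ⊆
      (fun (ω : V → ℕ → Bool) u (i : Fin b) => ω u i) ⁻¹' {z | ¬ Function.Injective z} := by
    intro ω hω h
    refine hω fun u u' huu => h ?_
    funext i
    have := congrFun (congrArg ofLex huu) i
    simpa [ident] using this
  refine (measure_mono hsub).trans ?_
  rw [hmp.measure_preimage (Set.toFinite _).measurableSet.nullMeasurableSet]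
  exact iidLaw_not_injective_le _ fun z => by simp [iidLaw_coin_singleton]

lemma measurePreserving_color (V : Type) [Fintype V] (k b : ℕ) :
    MeasurePreserving (fun (ω : V → ℕ → Bool) u => color k b (ω u)) (randomBits V)
      (iidLaw V (iidLaw ℕ (iidLaw (Fin k) coin))) := by
  rw [randomBits_eq_iidLaw]
  have hinj : Function.Injective
      fun q : (V × ℕ) × Fin k => (q.1.1, b + q.1.2 * k + (q.2 : ℕ)) := by
    rintro ⟨⟨u, c⟩, i⟩ ⟨⟨u', c'⟩, i'⟩ h
    simp only [Prod.mk.injEq] at h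
    obtain ⟨rfl, h⟩ := h
    have h' : (i : ℕ) + k * c = i' + k * c' := by
      rw [mul_comm k c, mul_comm k c']; omega
    have hk : 0 < k := i.pos
    have hc : c = c' := by
      have := congrArg (· / k) h'
      simpa [Nat.add_mul_div_left _ _ hk, Nat.div_eq_of_lt i.2, Nat.div_eq_of_lt i'.2] using this
    subst hc
    obtain rfl : i = i' := Fin.ext (by omega)
    rfl
  exact (measurePreserving_iidLaw_curry (ι := V) (κ := ℕ) (iidLaw (Fin k) coin)).comp
    ((measurePreserving_iidLaw_curry (ι := V × ℕ) (κ := Fin k) coin).comp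
      ((measurePreserving_iidLaw_comp coin hinj).comp (measurePreserving_iidLaw_uncurry coin)))

lemma ident_truncateBits {b M : ℕ} (h : b ≤ M) (ω : ℕ → Bool) :
    ident b (truncateBits M ω) = ident b ω := by
  unfold ident truncateBits
  congr 1
  funext i
  by_cases hi : i < b
  · simp [hi, show i < M by omega]
  · simp [hi]

lemma color_truncateBits {k b K M : ℕ} (h : b + (K + 1) * k ≤ M) {c : ℕ} (hc : c ≤ K)
    (ω : ℕ → Bool) : color k b (truncateBits M ω) c = color k b ω c := by
  funext i
  have : b + c * k + i < M := by
    have h₁ : c * k ≤ K * k := Nat.mul_le_mul_right k hc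
    have h₂ : (K + 1) * k = K * k + k := by ring
    have := i.2
    omega
  simp [color, truncateBits, this]

variable {Inp Out Msg : Type} (T : Simulation Inp Out Msg) {Δ : ℕ}

/-- The number of random bits that are used in networks with `n` vertices. -/
def bitsUsed (k n : ℕ) : ℕ := idLength n + (iterations n + 1) * k

/-- The failure probability: identifiers of `3 * log n + 1` bits collide with probability at most
`1 / (2 * n)`, and `2 * log n + 1` iterations of resampling leave a violation with probability at
most `1 / (2 * n)`. -/
lemma failure_le (n : ℕ) :
    (n : ENNReal) ^ 2 * 2⁻¹ ^ idLength n + n * 2⁻¹ ^ iterations n ≤ (n : ENNReal)⁻¹ := by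
  rcases eq_or_ne n 0 with rfl | hn
  · simp
  have hn0 : (n : ENNReal) ≠ 0 := by exact_mod_cast hn
  have hnt : (n : ENNReal) ≠ ⊤ := ENNReal.natCast_ne_top n
  have hl : (2⁻¹ : ENNReal) ^ Nat.clog 2 n ≤ (n : ENNReal)⁻¹ := by
    rw [← ENNReal.inv_pow, ENNReal.inv_le_inv]
    exact_mod_cast Nat.le_pow_clog one_lt_two n
  have h₁ : (n : ENNReal) ^ 2 * 2⁻¹ ^ idLength n ≤ 2⁻¹ * (n : ENNReal)⁻¹ := by
    calc (n : ENNReal) ^ 2 * 2⁻¹ ^ idLength n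
        = (n : ENNReal) ^ 2 * ((2⁻¹ ^ Nat.clog 2 n) ^ 3 * 2⁻¹) := by
          rw [idLength, pow_succ (2⁻¹ : ENNReal), mul_comm 3, pow_mul (2⁻¹ : ENNReal)]
      _ ≤ (n : ENNReal) ^ 2 * (((n : ENNReal)⁻¹) ^ 3 * 2⁻¹) := by gcongr
      _ = (n * (n : ENNReal)⁻¹) ^ 2 * (2⁻¹ * (n : ENNReal)⁻¹) := by ring
      _ = 2⁻¹ * (n : ENNReal)⁻¹ := by
          rw [ENNReal.mul_inv_cancel hn0 hnt, one_pow, one_mul]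
  have h₂ : (n : ENNReal) * 2⁻¹ ^ iterations n ≤ 2⁻¹ * (n : ENNReal)⁻¹ := by
    calc (n : ENNReal) * 2⁻¹ ^ iterations n
        = n * ((2⁻¹ ^ Nat.clog 2 n) ^ 2 * 2⁻¹) := by
          rw [iterations, pow_succ (2⁻¹ : ENNReal), mul_comm 2, pow_mul (2⁻¹ : ENNReal)]
      _ ≤ n * (((n : ENNReal)⁻¹) ^ 2 * 2⁻¹) := by gcongr
      _ = (n * (n : ENNReal)⁻¹) * (2⁻¹ * (n : ENNReal)⁻¹) := by ring
      _ = 2⁻¹ * (n : ENNReal)⁻¹ := by rw [ENNReal.mul_inv_cancel hn0 hnt, one_mul]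
  calc _ ≤ 2⁻¹ * (n : ENNReal)⁻¹ + 2⁻¹ * (n : ENNReal)⁻¹ := add_le_add h₁ h₂
    _ = (n : ENNReal)⁻¹ := by rw [← add_mul, ENNReal.inv_two_add_inv_two, one_mul]

/-- The solver fails only if the identifiers collide or a violation survives the resampling. -/
lemma randomBits_solver_not_correct_le {p : ENNReal}
    (hp : ∀ (V : Type) [Fintype V] (N : Network V Inp), (∀ v, N.deg v ≤ Δ) → ∀ v,
      iidLaw V (iidLaw (Fin T.k) coin) {y | T.P.Violated N (T.out N y) v} ≤ p)
    (hpd : (1 + 4 * p) ^ (Δ + 1) ^ (4 * T.radius) ≤ 2) (hp2 : p * 2 ≤ 1)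
    {V : Type} [Fintype V] (N : Network V Inp) (hΔ : ∀ v, N.deg v ≤ Δ) :
    randomBits V {ω | ¬ T.P.Correct N ((T.solver Δ).run T.viewRadius N
      fun u => truncateBits (bitsUsed T.k (Fintype.card V)) (ω u))} ≤
      (Fintype.card V : ENNReal)⁻¹ := by
  set n := Fintype.card V with hn
  let b := idLength n
  let K := iterations n
  let E : Set (V → ℕ → Fin T.k → Bool) := {X | ∃ id : V → Ident, Function.Injective id ∧
    ∃ v, (T.system N).bad ((T.system N).current id X K) v}
  have hsub : {ω | ¬ T.P.Correct N ((T.solver Δ).run T.viewRadius N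
      fun u => truncateBits (bitsUsed T.k n) (ω u))} ⊆
      {ω | ¬ Function.Injective fun u => ident b (ω u)} ∪
        (fun (ω : V → ℕ → Bool) u => color T.k b (ω u)) ⁻¹' E := by
    intro ω hω
    by_cases hid : Function.Injective fun u => ident b (ω u)
    · right
      refine ⟨_, hid, ?_⟩
      have hident : ∀ u, ident (idLength n) (truncateBits (bitsUsed T.k n) (ω u)) =
          ident b (ω u) := fun u => ident_truncateBits (Nat.le_add_right _ _) _
      rw [Set.mem_ofPred_eq, T.solver_run_eq _ hΔ (by simpa only [← hn, hident] using hid),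
        LCL.correct_iff] at hω
      push Not at hω
      obtain ⟨v, hv⟩ := hω
      refine ⟨v, ?_⟩
      simp only [← hn, hident] at hv
      have hcur := EventSystem.current_congr (S := T.system N) (id := fun u => ident b (ω u))
        (X := fun u => color T.k b (truncateBits (bitsUsed T.k n) (ω u)))
        (X' := fun u => color T.k b (ω u)) (i := K)
        fun u c hc => color_truncateBits le_rfl hc _
      rw [← hcur]
      exact hv
    · exact Or.inl hid
  calc _ ≤ randomBits V {ω | ¬ Function.Injective fun u => ident b (ω u)} +
        randomBits V ((fun (ω : V → ℕ → Bool) u => color T.k b (ω u)) ⁻¹' E) :=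
        (measure_mono hsub).trans (measure_union_le _ _)
    _ ≤ (n : ENNReal) ^ 2 * 2⁻¹ ^ b + n * 2⁻¹ ^ K := by
        refine add_le_add (randomBits_ident_not_injective_le V b) ?_
        have hmp := measurePreserving_color V T.k b
        refine (Measure.le_map_apply hmp.measurable.aemeasurable E).trans ?_
        rw [hmp.map_eq]
        exact EventSystem.measure_exists_bad_le _ (fun w => hp V N hΔ w) (T.ncard_rel_le hΔ)
          hpd hp2 K
    _ ≤ (n : ENNReal)⁻¹ := failure_le n

lemma isBigO_solver_rounds :
    (fun n : ℕ => (((T.solver Δ).rounds n : ℕ) : ℝ)) =O[atTop] fun n : ℕ => Real.log n := by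
  refine IsBigO.of_bound (5 / Real.log 2 + 8 / Real.log 2) ?_
  filter_upwards [eventually_ge_atTop 2] with n hn
  have hlog2 : 0 < Real.log 2 := Real.log_pos one_lt_two
  have hlogn : Real.log 2 ≤ Real.log n :=
    Real.log_le_log (by norm_num) (by exact_mod_cast hn)
  have hclog : (Nat.clog 2 n : ℝ) ≤ Real.log n / Real.log 2 + 1 := by
    have h : 2 ^ (Nat.clog 2 n - 1) < n := Nat.pow_pred_clog_lt_self one_lt_two (by omega)
    have hpos : 0 < Nat.clog 2 n := Nat.clog_pos one_lt_two hn
    have h' : ((2 : ℝ) ^ (Nat.clog 2 n - 1)) ≤ n := by exact_mod_cast h.le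
    have h'' := Real.log_le_log (by positivity) h'
    rw [Real.log_pow, Nat.cast_sub hpos, Nat.cast_one, ← le_div_iff₀ hlog2] at h''
    linarith
  have hone : 1 ≤ Real.log n / Real.log 2 := (one_le_div hlog2).mpr hlogn
  rw [Real.norm_of_nonneg (Nat.cast_nonneg _), Real.norm_of_nonneg (hlog2.le.trans hlogn)]
  have hr : (T.solver Δ).rounds n = 5 * Nat.clog 2 n + 3 := by
    simp only [solver, idLength, iterations]; ring
  rw [hr]
  push_cast
  calc (5 * (Nat.clog 2 n : ℝ) + 3) ≤ 5 * (Real.log n / Real.log 2) + 8 * 1 := by linarith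
    _ ≤ 5 * (Real.log n / Real.log 2) + 8 * (Real.log n / Real.log 2) := by gcongr
    _ = (5 / Real.log 2 + 8 / Real.log 2) * Real.log n := by ring

/-- If a violation at a given vertex is unlikely enough when the colors are chosen at random, then
`P` can be solved with one-bit messages in a logarithmic number of rounds. -/
theorem exists_bool_solves [Finite Inp] {p : ENNReal}
    (hp : ∀ (V : Type) [Fintype V] (N : Network V Inp), (∀ v, N.deg v ≤ Δ) → ∀ v,
      iidLaw V (iidLaw (Fin T.k) coin) {y | T.P.Violated N (T.out N y) v} ≤ p)
    (hpd : (1 + 4 * p) ^ (Δ + 1) ^ (4 * T.radius) ≤ 2) (hp2 : p * 2 ≤ 1) :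
    ∃ B : RandLocalAlgorithm Inp Out Bool, B.Solves T.P Δ ∧
      (fun n : ℕ => (B.rounds n : ℝ)) =O[atTop] fun n : ℕ => Real.log n := by
  obtain ⟨L, B, hB, hrun⟩ := (T.solver Δ).exists_bool_simulation (R := T.viewRadius)
    (by simp [viewRadius])
  refine ⟨B.truncate (bitsUsed T.k), fun V _ N hΔ =>
    ⟨B.measurableSet_truncate_run_eq _ N, ?_⟩, ?_⟩
  · simp only [B.truncate_run, hrun]
    exact T.randomBits_solver_not_correct_le hp hpd hp2 N hΔ
  · have h : (fun n : ℕ => ((B.truncate (bitsUsed T.k)).rounds n : ℝ)) =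
        fun n => (L : ℝ) * ((T.solver Δ).rounds n : ℕ) := by
      funext n
      rw [← Nat.cast_mul, ← hB]
      rfl
    rw [h]
    exact T.isBigO_solver_rounds.const_mul_left _

end Simulation

/-! ### Choosing the constant -/

lemma one_add_pow_le_two {d : ℕ} {a : ENNReal} (h : 2 * d * a ≤ 1) : (1 + a) ^ d ≤ 2 := by
  have key : ∀ j ≤ d, (1 + a) ^ j ≤ 1 + 2 * j * a := by
    intro j
    induction j with
    | zero => simp
    | succ j ih =>
      intro hj
      have hja : 2 * (j : ENNReal) * a ≤ 1 := by
        refine le_trans ?_ h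
        gcongr
        omega
      calc (1 + a) ^ (j + 1) = (1 + a) ^ j * (1 + a) := pow_succ _ _
        _ ≤ (1 + 2 * j * a) * (1 + a) := by gcongr; exact ih (by omega)
        _ = 1 + 2 * j * a + a + 2 * j * a * a := by ring
        _ ≤ 1 + 2 * j * a + a + 1 * a := by gcongr
        _ = 1 + 2 * (j + 1 : ℕ) * a := by push_cast; ring
  calc (1 + a) ^ d ≤ 1 + 2 * d * a := key d le_rfl
    _ ≤ 1 + 1 := by gcongr
    _ = 2 := one_add_one_eq_two

/-- Since `c ^ T(n)` is smaller than any power of `n` for `T(n) = o(log n)`, there is a constant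
number of vertices that is large compared with all balls that matter. -/
lemma exists_const_mul_pow_le {T : ℕ → ℕ}
    (hT : (fun n : ℕ => (T n : ℝ)) =o[atTop] fun n : ℕ => Real.log n) (Δ r c C : ℕ) :
    ∃ m : ℕ, m ≠ 0 ∧ C * (Δ + 1) ^ (c * (r + T m)) ≤ m := by
  set q : ℝ := Real.log (Δ + 1 : ℝ) with hq
  have hq0 : 0 ≤ q := Real.log_nonneg (by linarith [(Nat.cast_nonneg Δ : (0 : ℝ) ≤ Δ)])
  have h₁ : (fun n : ℕ => c * q * (T n : ℝ)) =o[atTop] fun n : ℕ => Real.log n :=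
    hT.const_mul_left _
  have hlog : Tendsto (fun n : ℕ => Real.log n) atTop atTop :=
    Real.tendsto_log_atTop.comp tendsto_natCast_atTop_atTop
  have h₂ := h₁.bound (show (0 : ℝ) < 1 / 2 by norm_num)
  have h₃ := hlog.eventually_ge_atTop (2 * (Real.log (C + 1 : ℝ) + c * q * r))
  obtain ⟨m, hm₂, hm₃, hm⟩ := (h₂.and (h₃.and (eventually_gt_atTop 0))).exists
  refine ⟨m, hm.ne', ?_⟩
  have hm0 : (0 : ℝ) < m := by exact_mod_cast hm
  have hlogm : 0 ≤ Real.log m := Real.log_natCast_nonneg m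
  rw [Real.norm_of_nonneg (by positivity), Real.norm_of_nonneg hlogm] at hm₂
  have hle : Real.log ((C + 1 : ℝ) * (Δ + 1 : ℝ) ^ (c * (r + T m))) ≤ Real.log m := by
    rw [Real.log_mul (by positivity) (by positivity), Real.log_pow, ← hq]
    push_cast
    nlinarith
  have hreal := (Real.log_le_log_iff (by positivity) hm0).mp hle
  have hnat : (C + 1) * (Δ + 1) ^ (c * (r + T m)) ≤ m := by exact_mod_cast hreal
  exact (Nat.mul_le_mul_right _ C.le_succ).trans hnat

theorem mainTheorem6 (Δ : ℕ) {Inp Out Msg : Type} [Finite Inp] [Finite Out]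
    (P : LCL Inp Out) (A : RandLocalAlgorithm Inp Out Msg) (hA : A.Solves P Δ)
    (hrounds : (fun n : ℕ => (A.rounds n : ℝ)) =o[atTop] fun n : ℕ => Real.log n) :
    ∃ B : RandLocalAlgorithm Inp Out Bool, B.Solves P Δ ∧
      (fun n : ℕ => (B.rounds n : ℝ)) =O[atTop] fun n : ℕ => Real.log n := by
  -- with `p = 2 / m`, the local lemma asks for `8 * p * d ≤ 1`; here `d` bounds the size of the
  -- balls that contain all events `rel`ated to a given one
  obtain ⟨m, hm, hle⟩ := exists_const_mul_pow_le hrounds Δ (P.radius + 1) 4 16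
  set d := (Δ + 1) ^ (4 * (P.radius + 1 + A.rounds m)) with hd
  have hd1 : 1 ≤ d := Nat.one_le_pow _ _ Δ.succ_pos
  have hball : (Δ + 1) ^ (P.radius + A.rounds m + 2) ≤ m := by
    refine le_trans ?_ ((Nat.le_mul_of_pos_left d (by norm_num : 0 < 16)).trans hle)
    exact Nat.pow_le_pow_right Δ.succ_pos (by omega)
  obtain ⟨k, e, he⟩ := exists_palette_violated_le hA hm hball
  let T : Simulation Inp Out Msg := ⟨P, A, m, k, e⟩
  have hm0 : (m : ENNReal) ≠ 0 := by exact_mod_cast hm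
  have hmt : (m : ENNReal) ≠ ⊤ := ENNReal.natCast_ne_top m
  have h16 : 16 * (d : ENNReal) * (m : ENNReal)⁻¹ ≤ 1 := by
    rw [← div_eq_mul_inv]
    exact ENNReal.div_le_of_le_mul (by rw [one_mul]; exact_mod_cast hle)
  refine T.exists_bool_solves (p := 2 * (m : ENNReal)⁻¹) he ?_ ?_
  · rw [show T.radius = P.radius + 1 + A.rounds m by simp only [Simulation.radius, T]; omega, ← hd]
    refine one_add_pow_le_two (le_of_eq_of_le ?_ h16)
    ring
  · refine le_trans ?_ h16
    rw [show (2 * (m : ENNReal)⁻¹) * 2 = 4 * 1 * (m : ENNReal)⁻¹ by ring]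
    gcongr
    · norm_num
    · exact_mod_cast hd1
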